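/- Let $\Omega$ be the space of polynomial mappings $F=(f_1,f_2,f_3):\mathbb C^2\to\mathbb C^3$ with $\deg f_i\le 2$, identified with $\mathbb C^{18}$ by means of the coefficients. For $F\in\Omega$ let $O(F)=\{L\circ F\circ R\}$ be its orbit, where $L$ and $R$ run over the affine automorphisms of $\mathbb C^3$ and $\mathbb C^2$ respectively; $\dim O(F)$ is the dimension of its Zariski closure in $\mathbb C^{18}$. A point is a singular point of $F$ if all $2\times 2$ minors of the Jacobian matrix of $F$ vanish there. The topological degree $\mu(F)$ is the number of points of $F^{-1}(F(p))$ for generic $p\in\mathbb C^2$. The self-intersection curve $SI_F$ is the set of $p\in\mathbb C^2$ such that the scheme-theoretic fibre $F^{-1}(F(p))$ is not a single reduced point; it carries the scheme structure given by the ideal $\big(I:(x_1-x_2,\,y_1-y_2)\big)\cap\mathbb C[x_1,y_1]$, where $I\subset\mathbb C[x_1,y_1,x_2,y_2]$ is generated by $f_i(x_1,y_1)-f_i(x_2,y_2)$, $i=1,2,3$. Theorem. For $F\in\Omega$ the following conditions are equivalent: (1) $F$ has exactly two singular points; (2) $(x^2+y,\;y^2+x,\;xy+ax+by)\in O(F)$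 for some $a,b\in\mathbb C$ with $2a^3+a^2b^2+\tfrac92ab+2b^3-\tfrac{27}{16}=0$ and $(a,b)\ne(-\tfrac32\varepsilon,-\tfrac32\varepsilon^2)$ for every $\varepsilon\in\mathbb C$ with $\varepsilon^3=1$; (3) $O(F)=O(F_2)$, i.e. $F\in O(F_2)$, where $F_2=(x^2+y,\;y^2+x,\;xy+\tfrac12x+\tfrac12y)$. Moreover, for such $F$ one has $\mu(F)=1$; the set $SI_F$ is the union of two transversal lines $\{\ell_1=0\}$ and $\{\ell_2=0\}$, where $\ell_1,\ell_2$ are polynomials of degree one with linearly independent linear parts; as a scheme it is given by the ideal $(\ell_1^2\ell_2)$, so that one of the lines is double; and $\dim O(F)=17$. -/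

import Mathlib

open MvPolynomial

noncomputable section

namespace QuadMap

/-- A triple of polynomials in two variables over `ℂ` (the variables are `X 0 = x`, `X 1 = y`). -/
abbrev Triple : Type := Fin 3 → MvPolynomial (Fin 2) ℂ

/-- The polynomial mapping `ℂ² → ℂ³` given by a triple. -/
def toMap (F : Triple) (p : Fin 2 → ℂ) : Fin 3 → ℂ := fun i => eval p (F i)

/-- The space of quadratic mappings `ℂ² → ℂ³`: all components have degree at most two. -/
def Omega : Set Triple := {F | ∀ i, (F i).totalDegree ≤ 2}

/-- The orbit of `F` under `(L, R) F = L ∘ F ∘ R`, with `L`, `R` affine automorphisms of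
`ℂ³` and `ℂ²`. -/
def orbit (F : Triple) : Set Triple :=
  {G | G ∈ Omega ∧
    ∃ (L : (Fin 3 → ℂ) ≃ᵃ[ℂ] (Fin 3 → ℂ)) (R : (Fin 2 → ℂ) ≃ᵃ[ℂ] (Fin 2 → ℂ)),
      ∀ p, toMap G p = L (toMap F (R p))}

/-- The Jacobian determinant of a pair of polynomials in `x, y`. -/
def jac (f g : MvPolynomial (Fin 2) ℂ) : MvPolynomial (Fin 2) ℂ :=
  pderiv 0 f * pderiv 1 g - pderiv 1 f * pderiv 0 g

/-- The set of singular (critical) points: the common zeros of the three `2 × 2` minors of the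
Jacobian matrix. -/
def criticalSet (F : Triple) : Set (Fin 2 → ℂ) :=
  {p | eval p (jac (F 1) (F 2)) = 0 ∧ eval p (jac (F 2) (F 0)) = 0 ∧
    eval p (jac (F 0) (F 1)) = 0}

/-- `F` has topological degree `n`: for all `p` outside a proper algebraic subset of the plane,
the fibre of `F` through `p` has exactly `n` points. -/
def HasTopDegree (F : Triple) (n : ℕ) : Prop :=
  ∃ h : MvPolynomial (Fin 2) ℂ, h ≠ 0 ∧
    ∀ p, eval p h ≠ 0 → {q | toMap F q = toMap F p}.encard = n

/-- The ideal of the scheme-theoretic fibre of `F` through `p`. -/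
def fibreIdeal (F : Triple) (p : Fin 2 → ℂ) : Ideal (MvPolynomial (Fin 2) ℂ) :=
  Ideal.span (Set.range fun i => F i - C (eval p (F i)))

/-- The self-intersection set: the points `p` for which the scheme-theoretic fibre through `p` is
not the reduced point `p`. -/
def selfIntersectionSet (F : Triple) : Set (Fin 2 → ℂ) :=
  {p | fibreIdeal F p ≠ vanishingIdeal ℂ {p}}

/-- The ideal of the self-intersection scheme: with `I` generated by the
`fᵢ(x₁,y₁) - fᵢ(x₂,y₂)`, it is the contraction to `ℂ[x₁,y₁]` of `I : (x₁ - x₂, y₁ - y₂)`.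
The left summand of `Fin 2 ⊕ Fin 2` indexes `x₁, y₁`, the right one `x₂, y₂`. -/
def selfIntersectionIdeal (F : Triple) : Ideal (MvPolynomial (Fin 2) ℂ) :=
  Ideal.comap (rename (Sum.inl : Fin 2 → Fin 2 ⊕ Fin 2))
    (Submodule.colon
      (Ideal.span (Set.range fun i => rename Sum.inl (F i) - rename Sum.inr (F i)))
      (Ideal.span (Set.range fun j : Fin 2 =>
        (X (Sum.inl j) - X (Sum.inr j) : MvPolynomial (Fin 2 ⊕ Fin 2) ℂ)) :
        Set (MvPolynomial (Fin 2 ⊕ Fin 2) ℂ)))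

/-- The exponents of the monomials `x², xy, y², x, y, 1`. -/
def monomialExp : Fin 6 → (Fin 2 →₀ ℕ) :=
  ![Finsupp.single 0 2, Finsupp.single 0 1 + Finsupp.single 1 1, Finsupp.single 1 2,
    Finsupp.single 0 1, Finsupp.single 1 1, 0]

/-- The coefficient vector, identifying `Omega` with the affine space `ℂ¹⁸`. -/
def coeffVec (F : Triple) : Fin 3 × Fin 6 → ℂ := fun ij => coeff (monomialExp ij.2) (F ij.1)

/-- The dimension of a subset `S` of `Omega ≅ ℂ¹⁸`: the Krull dimension of the coordinate ring of
its Zariski closure. -/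
def dimension (S : Set Triple) : WithBot ℕ∞ :=
  ringKrullDim (MvPolynomial (Fin 3 × Fin 6) ℂ ⧸ vanishingIdeal ℂ (coeffVec '' S))

/-- The triple `(x² + y, y² + x, xy + a x + b y)`. -/
def family (a b : ℂ) : Triple :=
  ![X 0 ^ 2 + X 1, X 1 ^ 2 + X 0, X 0 * X 1 + C a * X 0 + C b * X 1]

/-- The polynomial `a x + b y + c`. -/
def linePoly (a b c : ℂ) : MvPolynomial (Fin 2) ℂ := C a * X 0 + C b * X 1 + C c

end QuadMap

end

open MvPolynomial

noncomputable section

namespace QuadMap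


/-! Everything rests on one normal form: a quadratic map with exactly two singular points is
affinely equivalent to N = (x² + x, xy, y²). Put a singular point at the origin with kernel
direction the y-axis. If the quadratic parts were dependent, the singular set would contain a conic
or be a linear subspace, never two points. Otherwise a linear change of the target gives (x² + αx,
xy + βx, y² + γx), and having two singular points leaves two cases for (α, β, γ), each brought to N
by an explicit change (`normalForm_mem_orbit_of_ncard_eq_two`). Hence all such maps form a single
orbit, and each invariant can be computed on N and transported.

For a map (x², xy, y²) + M(x, y) with M₀₁ ≠ 0, singular points correspond to the roots of a cubic
(`critSet_monicMap`); two singular points mean a double root that is not triple. For the family the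
equation in a, b is the vanishing of the discriminant, and the excluded pairs are the triple roots.
The same cubic gives the dimension: the discriminant is one equation on ℂ¹⁸, so the dimension is at
most 17, and it can be solved after prescribing 17 independent functions generically.

On N, (x, 0) and (-1 - x, 0) have the same image, as do (0, y) and (0, -y). Along y = 0 the two
sheets share the tangent plane, which makes that line double; dual numbers detect this
(`sq_dvd_of_mem_selfIntersectionIdeal`). -/

/-! ### Krull dimension and algebraic independence -/

/-- Chains of primes lift by going up; injectivity puts the kernel inside the smallest prime, so
lying over starts the chain. -/
theorem ringKrullDim_le_of_isIntegral_of_injective {R S : Type*} [CommRing R] [CommRing S]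
    (f : R →+* S) (hf : f.IsIntegral) (hinj : Function.Injective f) :
    ringKrullDim R ≤ ringKrullDim S := by
  algebraize [f]
  have hker : RingHom.ker (algebraMap R S) = ⊥ := (RingHom.injective_iff_ker_eq_bot f).mp hinj
  refine iSup_le fun l => ?_
  obtain ⟨Q, _, hQ, hQl⟩ := Ideal.exists_ideal_over_prime_of_isIntegral l.head.asIdeal
    (⊥ : Ideal S) (by
      change RingHom.ker (algebraMap R S) ≤ _
      rw [hker]; exact bot_le)
  have : Q.LiesOver l.head.asIdeal := ⟨hQl.symm⟩
  obtain ⟨L, hL, -⟩ := Ideal.exists_ltSeries_of_hasGoingUp l Q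
  exact le_iSup_of_le L (by rw [hL])

/-- The Krull dimension of a finitely generated algebra over a field is bounded below by the size
of any finite algebraically independent family. -/
theorem card_le_ringKrullDim_of_algebraicIndependent {k A ι : Type} [Field k] [CommRing A]
    [Algebra k A] [Algebra.FiniteType k A] [Finite ι] {x : ι → A}
    (hx : AlgebraicIndependent k x) : (Nat.card ι : WithBot ℕ∞) ≤ ringKrullDim A := by
  -- A prime contracting to zero in the polynomial ring keeps the family independent modulo it,
  -- which reduces to the domain `A ⧸ P`.
  obtain ⟨P, hP, hPx⟩ := Ideal.exists_comap_eq_of_mem_minimalPrimes_of_injective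
    (f := (aeval x : MvPolynomial ι k →ₐ[k] A).toRingHom) hx ⊥ (by
      rw [IsDomain.minimalPrimes_eq_singleton_bot]; rfl)
  have hy : AlgebraicIndependent k (fun i => Ideal.Quotient.mkₐ k P (x i)) := by
    rw [algebraicIndependent_iff]
    intro p hp
    have h1 : Ideal.Quotient.mkₐ k P (aeval x p) = 0 := by
      rw [← hp]
      change ((Ideal.Quotient.mkₐ k P).comp (aeval x)) p = _
      rw [comp_aeval]
    have h2 : p ∈ P.comap (aeval x : MvPolynomial ι k →ₐ[k] A).toRingHom :=
      (Ideal.Quotient.eq_zero_iff_mem (I := P)).mp h1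
    rwa [hPx] at h2
  refine le_trans ?_ (ringKrullDim_quotient_le P)
  obtain ⟨s, g, hg, hgi⟩ := exists_integral_inj_algHom_of_fg k (A ⧸ P)
  refine le_trans ?_ (ringKrullDim_le_of_isIntegral_of_injective g.toRingHom hgi hg)
  rw [MvPolynomial.ringKrullDim_of_isNoetherianRing, ringKrullDim_eq_zero_of_field, zero_add]
  have hb : AlgebraicIndependent k (fun i => g (X i)) := by
    rw [algebraicIndependent_iff]
    intro p hp
    have h1 : g p = 0 := by
      rw [← hp]
      change _ = (aeval fun i => g (X i)) p
      rw [← comp_aeval, aeval_X_left]; rfl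
    exact hg (by rw [h1, map_zero])
  -- `A ⧸ P` is integral over the image of the `s` Noether variables, so its transcendence degree is
  -- at most `s`.
  have htr : Algebra.trdeg k (A ⧸ P) ≤ Cardinal.mk (Set.range fun i => g (X i)) := by
    have hadj : Algebra.adjoin k (Set.range fun i => g (X i)) = g.range := by
      rw [← Algebra.map_top, ← MvPolynomial.adjoin_range_X, AlgHom.map_adjoin, ← Set.range_comp]
      rfl
    have : Algebra.IsIntegral (Algebra.adjoin k (Set.range fun i => g (X i))) (A ⧸ P) := by
      refine ⟨fun a => ?_⟩
      obtain ⟨q, hq, hqa⟩ := hgi a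
      refine ⟨q.map (g.toRingHom.codRestrict (Algebra.adjoin k (Set.range fun i => g (X i)))
        (fun b => by rw [hadj]; exact ⟨b, rfl⟩)), hq.map _, ?_⟩
      rw [Polynomial.eval₂_map]
      exact hqa
    have : Algebra.IsAlgebraic (Algebra.adjoin k (Set.range fun i => g (X i))) (A ⧸ P) :=
      ⟨fun a => (Algebra.IsIntegral.isIntegral a).isAlgebraic⟩
    exact Algebra.IsAlgebraic.trdeg_le_cardinalMk k _
  have h3 := hy.cardinalMk_le_trdeg.trans htr
  have h4 : Cardinal.mk (Set.range fun i => g (X i)) ≤ (s : Cardinal) :=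
    Cardinal.mk_range_le.trans (by simp)
  have h5 := h3.trans h4
  rw [← Nat.cast_card, Nat.cast_le] at h5
  simp only [Nat.card_eq_fintype_card, Fintype.card_fin]
  exact_mod_cast h5


/-! ### Quadratic polynomials and their coefficients -/

/-- The polynomial of degree at most two with given coefficients of `x², xy, y², x, y, 1`. -/
def ofCoeff (v : Fin 6 → ℂ) : MvPolynomial (Fin 2) ℂ := ∑ j, monomial (monomialExp j) (v j)

theorem monomialExp_injective : Function.Injective monomialExp := by
  intro i j h
  have h0 := DFunLike.congr_fun h 0
  have h1 := DFunLike.congr_fun h 1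
  fin_cases i <;> fin_cases j <;> simp [monomialExp] at h0 h1 ⊢

theorem mem_range_monomialExp {m : Fin 2 →₀ ℕ} (hm : m.degree ≤ 2) :
    m ∈ Set.range monomialExp := by
  have hd : m 0 + m 1 ≤ 2 := by simpa [Finsupp.degree_eq_sum] using hm
  have key : ∀ j, m 0 = monomialExp j 0 → m 1 = monomialExp j 1 → m ∈ Set.range monomialExp :=
    fun j h0 h1 => ⟨j, by ext i; fin_cases i; exacts [h0.symm, h1.symm]⟩
  have h0 : m 0 ≤ 2 := by omega
  have h1 : m 1 ≤ 2 := by omega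
  generalize m 0 = a at *
  generalize m 1 = b at *
  interval_cases a <;> interval_cases b <;> first
    | omega
    | (refine key 0 ?_ ?_ <;> simp [monomialExp]; done)
    | (refine key 1 ?_ ?_ <;> simp [monomialExp]; done)
    | (refine key 2 ?_ ?_ <;> simp [monomialExp]; done)
    | (refine key 3 ?_ ?_ <;> simp [monomialExp]; done)
    | (refine key 4 ?_ ?_ <;> simp [monomialExp]; done)
    | (refine key 5 ?_ ?_ <;> simp [monomialExp])

theorem coeff_ofCoeff (v : Fin 6 → ℂ) (j : Fin 6) : coeff (monomialExp j) (ofCoeff v) = v j := by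
  simp [ofCoeff, coeff_sum, coeff_monomial, monomialExp_injective.eq_iff]

theorem degree_monomialExp_le (j : Fin 6) : (monomialExp j).degree ≤ 2 := by
  fin_cases j <;> simp [monomialExp, Finsupp.degree_eq_sum]

theorem totalDegree_ofCoeff_le (v : Fin 6 → ℂ) : (ofCoeff v).totalDegree ≤ 2 := by
  refine totalDegree_finsetSum_le fun j _ => (totalDegree_monomial_le _ _).trans ?_
  exact degree_monomialExp_le j

theorem ofCoeff_coeff {p : MvPolynomial (Fin 2) ℂ} (hp : p.totalDegree ≤ 2) :
    ofCoeff (fun j => coeff (monomialExp j) p) = p := by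
  ext m
  by_cases hm : m.degree ≤ 2
  · obtain ⟨j, rfl⟩ := mem_range_monomialExp hm
    rw [coeff_ofCoeff]
  · have key : ∀ q : MvPolynomial (Fin 2) ℂ, q.totalDegree ≤ 2 → coeff m q = 0 := fun q hq =>
      coeff_eq_zero_of_totalDegree_lt (by
        have : m.degree = ∑ i ∈ m.support, m i := rfl
        omega)
    rw [key _ (totalDegree_ofCoeff_le _), key _ hp]

theorem ofCoeff_eq (v : Fin 6 → ℂ) : ofCoeff v =
    C (v 0) * X 0 ^ 2 + C (v 1) * (X 0 * X 1) + C (v 2) * X 1 ^ 2 + C (v 3) * X 0 + C (v 4) * X 1 +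
      C (v 5) := by
  have h : ∀ (m : Fin 2 →₀ ℕ) (a : ℂ), monomial m a = C a * (X 0 ^ m 0 * X 1 ^ m 1) := by
    intro m a
    rw [monomial_eq, Finsupp.prod_fintype _ _ (fun _ => pow_zero _), Fin.prod_univ_two]
  simp [ofCoeff, Fin.sum_univ_six, h, monomialExp]

/-- The triple with a given coefficient vector. -/
def ofCoeffVec (z : Fin 3 × Fin 6 → ℂ) : Triple := fun i => ofCoeff fun j => z (i, j)

theorem ofCoeffVec_mem_Omega (z : Fin 3 × Fin 6 → ℂ) : ofCoeffVec z ∈ Omega :=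
  fun _ => totalDegree_ofCoeff_le _

theorem coeffVec_ofCoeffVec (z : Fin 3 × Fin 6 → ℂ) : coeffVec (ofCoeffVec z) = z := by
  ext ⟨i, j⟩
  exact coeff_ofCoeff _ j

theorem ofCoeffVec_coeffVec {F : Triple} (hF : F ∈ Omega) : ofCoeffVec (coeffVec F) = F :=
  funext fun i => ofCoeff_coeff (hF i)

theorem toMap_ofCoeffVec (z : Fin 3 × Fin 6 → ℂ) (p : Fin 2 → ℂ) (i : Fin 3) :
    toMap (ofCoeffVec z) p i = z (i, 0) * p 0 ^ 2 + z (i, 1) * (p 0 * p 1) + z (i, 2) * p 1 ^ 2 +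
      z (i, 3) * p 0 + z (i, 4) * p 1 + z (i, 5) := by
  simp [toMap, ofCoeffVec, ofCoeff_eq]

/-! ### Critical points in terms of values -/

/-- The points where a quadratic map `f` is not immersive: for such a map
`f (p + v) - f (p - v)` is twice the derivative at `p` along `v`. -/
def critSet (f : (Fin 2 → ℂ) → Fin 3 → ℂ) : Set (Fin 2 → ℂ) :=
  {p | ∃ v ≠ 0, f (p + v) = f (p - v)}

theorem exists_kernel_iff_minors (a b : Fin 3 → ℂ) :
    (∃ v : Fin 2 → ℂ, v ≠ 0 ∧ ∀ i, a i * v 0 + b i * v 1 = 0) ↔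
      a 1 * b 2 - b 1 * a 2 = 0 ∧ a 2 * b 0 - b 2 * a 0 = 0 ∧ a 0 * b 1 - b 0 * a 1 = 0 := by
  constructor
  · rintro ⟨v, hv, h⟩
    have hv' : v 0 ≠ 0 ∨ v 1 ≠ 0 := by
      by_contra! hc
      exact hv (by ext i; fin_cases i; exacts [hc.1, hc.2])
    have key : ∀ i j, a i * b j - b i * a j = 0 := by
      intro i j
      rcases hv' with h0 | h0
      · refine (mul_eq_zero.mp ?_).resolve_left h0
        linear_combination b j * h i - b i * h j
      · refine (mul_eq_zero.mp ?_).resolve_left h0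
        linear_combination a i * h j - a j * h i
    exact ⟨key 1 2, key 2 0, key 0 1⟩
  · rintro ⟨h12, h20, h01⟩
    by_cases hz : ∀ i, a i = 0 ∧ b i = 0
    · exact ⟨![1, 0], by simp, fun i => by simp [(hz i).1]⟩
    · simp only [not_forall, not_and_or] at hz
      obtain ⟨i, hi⟩ := hz
      refine ⟨![b i, -a i], fun h => ?_, fun j => ?_⟩
      · have e0 := congrFun h 0
        have e1 := congrFun h 1
        simp at e0 e1
        tauto
      · fin_cases i <;> fin_cases j <;> simp <;> grind

/-- The symmetric difference of a quadratic map is exactly linear in the direction, so criticality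
becomes a condition on values alone. Invariance under affine changes then needs no chain rule. -/
theorem criticalSet_eq_critSet {F : Triple} (hF : F ∈ Omega) :
    criticalSet F = critSet (toMap F) := by
  rw [← ofCoeffVec_coeffVec hF]
  generalize coeffVec F = z
  ext p
  have hp0 : ∀ i, eval p (pderiv 0 (ofCoeffVec z i)) =
      2 * z (i, 0) * p 0 + z (i, 1) * p 1 + z (i, 3) := by
    intro i
    simp [ofCoeffVec, ofCoeff_eq, pderiv_X]
    ring
  have hp1 : ∀ i, eval p (pderiv 1 (ofCoeffVec z i)) =
      z (i, 1) * p 0 + 2 * z (i, 2) * p 1 + z (i, 4) := by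
    intro i
    simp [ofCoeffVec, ofCoeff_eq, pderiv_X]
    ring
  have h := exists_kernel_iff_minors (fun i => eval p (pderiv 0 (ofCoeffVec z i)))
    (fun i => eval p (pderiv 1 (ofCoeffVec z i)))
  simp only [criticalSet, jac, map_sub, map_mul, Set.mem_ofPred_eq]
  rw [← h]
  refine exists_congr fun v => and_congr_right fun _ => ?_
  rw [funext_iff]
  refine forall_congr' fun i => ?_
  rw [hp0, hp1, toMap_ofCoeffVec, toMap_ofCoeffVec]
  simp only [Pi.add_apply, Pi.sub_apply]
  constructor
  · intro h; linear_combination 2 * h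
  · intro h; linear_combination h / 2

theorem critSet_comp (f : (Fin 2 → ℂ) → Fin 3 → ℂ) (L : (Fin 3 → ℂ) ≃ᵃ[ℂ] (Fin 3 → ℂ))
    (R : (Fin 2 → ℂ) ≃ᵃ[ℂ] (Fin 2 → ℂ)) :
    critSet (fun p => L (f (R p))) = R ⁻¹' critSet f := by
  ext p
  have hadd : ∀ v, R (p + v) = R p + R.linear v := fun v => by
    have := R.map_vadd p v
    simpa [add_comm] using this
  have hsub : ∀ v, R (p - v) = R p - R.linear v := fun v => by
    rw [sub_eq_add_neg, hadd, map_neg, ← sub_eq_add_neg]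
  simp only [critSet, Set.mem_ofPred_eq, Set.mem_preimage, L.injective.eq_iff]
  constructor
  · rintro ⟨v, hv, h⟩
    exact ⟨R.linear v, by simpa using hv, by rw [← hadd, ← hsub, h]⟩
  · rintro ⟨v, hv, h⟩
    exact ⟨R.linear.symm v, by simpa using hv, by simpa [hadd, hsub] using h⟩

theorem ncard_critSet_comp (f : (Fin 2 → ℂ) → Fin 3 → ℂ) (L : (Fin 3 → ℂ) ≃ᵃ[ℂ] (Fin 3 → ℂ))
    (R : (Fin 2 → ℂ) ≃ᵃ[ℂ] (Fin 2 → ℂ)) :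
    (critSet (fun p => L (f (R p)))).ncard = (critSet f).ncard := by
  rw [critSet_comp]
  exact Set.ncard_preimage_of_injective_subset_range R.injective (by simp [R.surjective.range_eq])

/-! ### Orbits -/

theorem mem_orbit_self {F : Triple} (hF : F ∈ Omega) : F ∈ orbit F :=
  ⟨hF, AffineEquiv.refl ℂ _, AffineEquiv.refl ℂ _, fun _ => rfl⟩

theorem mem_orbit_symm {F G : Triple} (hF : F ∈ Omega) (h : G ∈ orbit F) : F ∈ orbit G := by
  obtain ⟨-, L, R, h⟩ := h
  exact ⟨hF, L.symm, R.symm, fun p => by simp [h]⟩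

theorem mem_orbit_trans {F G H : Triple} (h : G ∈ orbit F) (h' : H ∈ orbit G) : H ∈ orbit F := by
  obtain ⟨-, L, R, h⟩ := h
  obtain ⟨hH, L', R', h'⟩ := h'
  exact ⟨hH, L.trans L', R'.trans R, fun p => by simp [h, h']⟩

theorem orbit_eq_of_mem {F G : Triple} (hF : F ∈ Omega) (h : G ∈ orbit F) : orbit G = orbit F :=
  Set.Subset.antisymm (fun _ hH => mem_orbit_trans h hH)
    (fun _ hH => mem_orbit_trans (mem_orbit_symm hF h) hH)

theorem ncard_criticalSet_of_mem_orbit {F G : Triple} (hF : F ∈ Omega) (h : G ∈ orbit F) :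
    (criticalSet G).ncard = (criticalSet F).ncard := by
  obtain ⟨hG, L, R, h⟩ := h
  rw [criticalSet_eq_critSet hF, criticalSet_eq_critSet hG, ← ncard_critSet_comp (toMap F) L R,
    ← funext h]


/-! ### Maps with exactly two critical points -/

/-- The affine automorphism `p ↦ M p + c` for an invertible matrix `M`. -/
def affineOfMatrix {n : ℕ} (M : Matrix (Fin n) (Fin n) ℂ) (hM : M.det ≠ 0) (c : Fin n → ℂ) :
    (Fin n → ℂ) ≃ᵃ[ℂ] (Fin n → ℂ) :=
  (Matrix.toLinearEquiv' M ((Matrix.isUnit_iff_isUnit_det M).mpr hM.isUnit).invertible).toAffineEquiv.trans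
    (AffineEquiv.constVAdd ℂ (Fin n → ℂ) c)

theorem affineOfMatrix_apply {n : ℕ} (M : Matrix (Fin n) (Fin n) ℂ) (hM : M.det ≠ 0)
    (c p : Fin n → ℂ) : affineOfMatrix M hM c p = M.mulVec p + c := by
  simp [affineOfMatrix, add_comm, Matrix.toLinearEquiv']

/-- The normal form `(x² + x, xy, y²)`. -/
def normalForm : Triple := ![X 0 ^ 2 + X 0, X 0 * X 1, X 1 ^ 2]

theorem toMap_normalForm (p : Fin 2 → ℂ) :
    toMap normalForm p = ![p 0 ^ 2 + p 0, p 0 * p 1, p 1 ^ 2] := by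
  ext i
  fin_cases i <;> simp [toMap, normalForm]

theorem normalForm_mem_Omega : normalForm ∈ Omega := by
  have : normalForm = ofCoeffVec fun ij => ![![1, 0, 0, 1, 0, 0], ![0, 1, 0, 0, 0, 0],
      ![0, 0, 1, 0, 0, 0]] ij.1 ij.2 := by
    funext i
    fin_cases i <;> simp [normalForm, ofCoeffVec, ofCoeff_eq]
  rw [this]
  exact ofCoeffVec_mem_Omega _

theorem normalForm_mem_orbit {F : Triple} (L : (Fin 3 → ℂ) ≃ᵃ[ℂ] (Fin 3 → ℂ))
    (R : (Fin 2 → ℂ) ≃ᵃ[ℂ] (Fin 2 → ℂ))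
    (h : ∀ p, L (toMap F (R p)) = ![p 0 ^ 2 + p 0, p 0 * p 1, p 1 ^ 2]) :
    normalForm ∈ orbit F :=
  ⟨normalForm_mem_Omega, L, R, fun p => by rw [h, toMap_normalForm]⟩

theorem exists_span_orthogonal (l : Fin 3 → ℂ) (hl : l ≠ 0) :
    ∃ e f : Fin 3 → ℂ, ∀ m : Fin 3 → ℂ, l 0 * m 0 + l 1 * m 1 + l 2 * m 2 = 0 →
      ∃ s t : ℂ, m = s • e + t • f := by
  have hl' : l 0 ≠ 0 ∨ l 1 ≠ 0 ∨ l 2 ≠ 0 := by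
    by_contra! hc
    exact hl (by ext i; fin_cases i; exacts [hc.1, hc.2.1, hc.2.2])
  rcases hl' with h | h | h
  · refine ⟨![-l 1 / l 0, 1, 0], ![-l 2 / l 0, 0, 1], fun m hm => ⟨m 1, m 2, ?_⟩⟩
    ext i
    fin_cases i <;> simp
    field_simp
    linear_combination hm
  · refine ⟨![1, -l 0 / l 1, 0], ![0, -l 2 / l 1, 1], fun m hm => ⟨m 0, m 2, ?_⟩⟩
    ext i
    fin_cases i <;> simp
    field_simp
    linear_combination hm
  · refine ⟨![1, 0, -l 0 / l 2], ![0, 1, -l 1 / l 2], fun m hm => ⟨m 0, m 1, ?_⟩⟩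
    ext i
    fin_cases i <;> simp
    field_simp
    linear_combination hm

theorem exists_quadratic_root {a : ℂ} (ha : a ≠ 0) (b c : ℂ) : ∃ x : ℂ, a * x ^ 2 + b * x + c = 0 := by
  obtain ⟨s, hs⟩ := IsAlgClosed.exists_pow_nat_eq (b ^ 2 - 4 * a * c) (n := 2) two_pos
  refine ⟨(-b + s) / (2 * a), ?_⟩
  field_simp
  linear_combination hs

/-- A conic through the origin has infinitely many points. -/
theorem infinite_conic (a b c d e : ℂ) :
    {p : Fin 2 → ℂ | a * p 0 ^ 2 + b * p 0 * p 1 + c * p 1 ^ 2 + d * p 0 + e * p 1 = 0}.Infinite := by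
  have key : ∀ s : Set ℂ, s.Infinite → (∀ y ∈ s, ∃ x : ℂ,
      a * x ^ 2 + b * x * y + c * y ^ 2 + d * x + e * y = 0) →
      {p : Fin 2 → ℂ | a * p 0 ^ 2 + b * p 0 * p 1 + c * p 1 ^ 2 + d * p 0 + e * p 1 = 0}.Infinite := by
    intro s hs h hfin
    refine hs ((hfin.image fun p => p 1).subset fun y hy => ?_)
    obtain ⟨x, hx⟩ := h y hy
    exact ⟨![x, y], by simpa using hx, rfl⟩
  -- Solve for x given y: a quadratic if a ≠ 0, otherwise a linear equation away from by + d = 0. If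
  -- a = b = d = 0 the conic contains the x-axis.
  by_cases ha : a = 0
  · by_cases hbd : b = 0 ∧ d = 0
    · obtain ⟨rfl, rfl⟩ := hbd
      subst ha
      refine Set.infinite_of_injective_forall_mem (f := fun x : ℂ => (![x, 0] : Fin 2 → ℂ))
        (fun x y h => by simpa using congrFun h 0) (fun x => by simp)
    · have hfin : {y : ℂ | b * y + d = 0}.Finite := by
        by_cases hb : b = 0
        · have : {y : ℂ | b * y + d = 0} = ∅ := by
            ext y; simp [hb] at hbd ⊢; exact hbd
          rw [this]; exact Set.finite_empty
        · refine (Set.finite_singleton (-d / b)).subset fun y hy => ?_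
          simp only [Set.mem_ofPred_eq] at hy
          simp only [Set.mem_singleton_iff]
          field_simp
          linear_combination hy
      refine key _ hfin.infinite_compl fun y hy => ?_
      simp only [Set.mem_compl_iff, Set.mem_ofPred_eq] at hy
      have hx := mul_div_cancel₀ (-(c * y ^ 2 + e * y)) hy
      refine ⟨-(c * y ^ 2 + e * y) / (b * y + d), ?_⟩
      rw [ha]
      linear_combination hx
  · refine key Set.univ Set.infinite_univ fun y _ => ?_
    obtain ⟨x, hx⟩ := exists_quadratic_root ha (b * y + d) (c * y ^ 2 + e * y)
    exact ⟨x, by linear_combination hx⟩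

/-- The quadratic map with columns of coefficients `A₁, A₂, A₃` at `x², xy, y²`, `u` at `x`, `0` at
`y` and constant term `c`. -/
def degenerateMap (A₁ A₂ A₃ u c : Fin 3 → ℂ) (p : Fin 2 → ℂ) : Fin 3 → ℂ :=
  p 0 ^ 2 • A₁ + (p 0 * p 1) • A₂ + p 1 ^ 2 • A₃ + p 0 • u + c

theorem mem_critSet_degenerateMap {A₁ A₂ A₃ u c : Fin 3 → ℂ} {p : Fin 2 → ℂ} :
    p ∈ critSet (degenerateMap A₁ A₂ A₃ u c) ↔ ∃ v : Fin 2 → ℂ, v ≠ 0 ∧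
      ∀ i, 2 * p 0 * v 0 * A₁ i + (p 0 * v 1 + p 1 * v 0) * A₂ i + 2 * p 1 * v 1 * A₃ i +
        v 0 * u i = 0 := by
  refine exists_congr fun v => and_congr_right fun _ => ?_
  rw [funext_iff]
  refine forall_congr' fun i => ?_
  simp only [degenerateMap, Pi.add_apply, Pi.sub_apply, Pi.smul_apply, smul_eq_mul]
  constructor
  · intro h; linear_combination h / 2
  · intro h; linear_combination 2 * h

/-- The form l kills the quadratic part, so l ∘ F is affine. If it is constant, the image lies in a
plane, only one Jacobian minor survives, and its zero set is a conic through the origin. Otherwise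
every kernel vector is vertical and the singular set is a linear subspace. -/
theorem ncard_critSet_ne_two_of_dependent {A₁ A₂ A₃ u c l : Fin 3 → ℂ} (hl : l ≠ 0)
    (h₁ : l 0 * A₁ 0 + l 1 * A₁ 1 + l 2 * A₁ 2 = 0)
    (h₂ : l 0 * A₂ 0 + l 1 * A₂ 1 + l 2 * A₂ 2 = 0)
    (h₃ : l 0 * A₃ 0 + l 1 * A₃ 1 + l 2 * A₃ 2 = 0) :
    (critSet (degenerateMap A₁ A₂ A₃ u c)).ncard ≠ 2 := by
  intro hcard
  have hfin : (critSet (degenerateMap A₁ A₂ A₃ u c)).Finite :=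
    Set.finite_of_ncard_ne_zero (by omega)
  by_cases hu : l 0 * u 0 + l 1 * u 1 + l 2 * u 2 = 0
  · obtain ⟨e, f, hef⟩ := exists_span_orthogonal l hl
    obtain ⟨a₁, b₁, rfl⟩ := hef _ h₁
    obtain ⟨a₂, b₂, rfl⟩ := hef _ h₂
    obtain ⟨a₃, b₃, rfl⟩ := hef _ h₃
    obtain ⟨a, b, rfl⟩ := hef _ hu
    -- Coefficients of the 2 × 2 Jacobian determinant in the coordinates along e and f.
    refine infinite_conic (2 * (a₁ * b₂ - a₂ * b₁)) (4 * (a₁ * b₃ - a₃ * b₁))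
      (2 * (a₂ * b₃ - a₃ * b₂)) (a * b₂ - a₂ * b) (2 * (a * b₃ - a₃ * b)) (hfin.subset fun p hp => ?_)
    simp only [Set.mem_ofPred_eq] at hp
    rw [mem_critSet_degenerateMap]
    obtain ⟨v, hv, h⟩ := (exists_kernel_iff_minors
      ![2 * p 0 * a₁ + p 1 * a₂ + a, 2 * p 0 * b₁ + p 1 * b₂ + b, 0]
      ![p 0 * a₂ + 2 * p 1 * a₃, p 0 * b₂ + 2 * p 1 * b₃, 0]).mpr (by
        refine ⟨by simp, by simp, ?_⟩
        simp
        linear_combination hp)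
    refine ⟨v, hv, fun i => ?_⟩
    have h0 := h 0
    have h1 := h 1
    simp at h0 h1 ⊢
    linear_combination e i * h0 + f i * h1
  · have hmem : ∀ p, p ∈ critSet (degenerateMap A₁ A₂ A₃ u c) ↔
        ∀ i, p 0 * A₂ i + 2 * p 1 * A₃ i = 0 := by
      intro p
      rw [mem_critSet_degenerateMap]
      constructor
      · rintro ⟨v, hv, h⟩
        have hv0 : v 0 = 0 := by
          refine (mul_eq_zero.mp ?_).resolve_right hu
          linear_combination l 0 * h 0 + l 1 * h 1 + l 2 * h 2 - 2 * p 0 * v 0 * h₁ -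
            (p 0 * v 1 + p 1 * v 0) * h₂ - 2 * p 1 * v 1 * h₃
        have hv1 : v 1 ≠ 0 := fun hv1 => hv (by ext i; fin_cases i; exacts [hv0, hv1])
        intro i
        refine (mul_eq_zero.mp ?_).resolve_left hv1
        have := h i
        rw [hv0] at this
        linear_combination this
      · intro h
        refine ⟨![0, 1], fun h => by simpa using congrFun h 1, fun i => ?_⟩
        simp
        linear_combination h i
    have hsmul : ∀ (t : ℂ) (p : Fin 2 → ℂ), p ∈ critSet (degenerateMap A₁ A₂ A₃ u c) →
        t • p ∈ critSet (degenerateMap A₁ A₂ A₃ u c) := by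
      intro t p hp
      rw [hmem] at hp ⊢
      intro i
      simp only [Pi.smul_apply, smul_eq_mul]
      linear_combination t * hp i
    obtain ⟨P, Q, hPQ, hS⟩ := Set.ncard_eq_two.mp hcard
    obtain ⟨p, hp, hp0⟩ : ∃ p ∈ critSet (degenerateMap A₁ A₂ A₃ u c), p ≠ 0 := by
      by_cases hP : P = 0
      · exact ⟨Q, by simp [hS], fun hQ => hPQ (hP.trans hQ.symm)⟩
      · exact ⟨P, by simp [hS], hP⟩
    exact Set.infinite_of_injective_forall_mem (f := fun t : ℂ => t • p)
      (smul_left_injective ℂ hp0) (fun t => hsmul t p hp) hfin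

/-- The singular points lie on x = 0 or 2x + α = 0. For α = 0 they are the origin and (0, -β); for α
≠ 0 they are the origin and the points of x = -α/2 with 4y² + 4βy + γα = 0, which must be a single
one. -/
theorem conditions_of_ncard_critSet_eq_two {α β γ : ℂ}
    (h : (critSet (degenerateMap ![1, 0, 0] ![0, 1, 0] ![0, 0, 1] ![α, β, γ] 0)).ncard = 2) :
    (α = 0 ∧ β ≠ 0) ∨ (α ≠ 0 ∧ β ^ 2 = γ * α) := by
  have hmem : ∀ p, p ∈ critSet (degenerateMap ![1, 0, 0] ![0, 1, 0] ![0, 0, 1] ![α, β, γ] 0) ↔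
      (p 0 * (2 * p 0 + α) = 0 ∧ p 1 * (2 * p 0 + α) = 0 ∧
        2 * p 1 * (p 1 + β) - γ * p 0 = 0) := by
    intro p
    have h := exists_kernel_iff_minors ![2 * p 0 + α, p 1 + β, γ] ![0, p 0, 2 * p 1]
    rw [mem_critSet_degenerateMap]
    have h' : (∃ v : Fin 2 → ℂ, v ≠ 0 ∧ ∀ i, 2 * p 0 * v 0 * (![1, 0, 0] : Fin 3 → ℂ) i +
        (p 0 * v 1 + p 1 * v 0) * (![0, 1, 0] : Fin 3 → ℂ) i +
        2 * p 1 * v 1 * (![0, 0, 1] : Fin 3 → ℂ) i +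
        v 0 * (![α, β, γ] : Fin 3 → ℂ) i = 0) ↔ (∃ v : Fin 2 → ℂ, v ≠ 0 ∧ ∀ i,
        (![2 * p 0 + α, p 1 + β, γ] : Fin 3 → ℂ) i * v 0 +
        (![0, p 0, 2 * p 1] : Fin 3 → ℂ) i * v 1 = 0) := by
      refine exists_congr fun v => and_congr_right fun _ => forall_congr' fun i => ?_
      rw [iff_iff_eq]
      congr 1
      fin_cases i <;> simp <;> ring
    rw [h', h]
    simp
    constructor
    · rintro ⟨h1, h2, h3⟩
      exact ⟨by simpa [or_comm, and_comm] using h3, by simpa [or_comm] using h2,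
        by linear_combination h1⟩
    · rintro ⟨h1, h2, h3⟩
      exact ⟨by linear_combination h3, by simpa [or_comm] using h2, by simpa [or_comm] using h1⟩
  obtain ⟨P, Q, hPQ, hS⟩ := Set.ncard_eq_two.mp h
  have hP := (hmem P).mp (by simp [hS])
  have hQ := (hmem Q).mp (by simp [hS])
  by_cases hα : α = 0
  · refine Or.inl ⟨hα, fun hβ => hPQ ?_⟩
    subst hα hβ
    have hzero : ∀ p : Fin 2 → ℂ, (p 0 * (2 * p 0 + 0) = 0 ∧ p 1 * (2 * p 0 + 0) = 0 ∧
        2 * p 1 * (p 1 + 0) - γ * p 0 = 0) → p = 0 := by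
      rintro p ⟨h1, -, h3⟩
      have hp0 : p 0 = 0 := by simpa using h1
      have hp1 : p 1 = 0 := by simpa [hp0] using h3
      ext i
      fin_cases i
      exacts [hp0, hp1]
    rw [hzero P hP, hzero Q hQ]
  · refine Or.inr ⟨hα, ?_⟩
    by_contra hne
    obtain ⟨s, hs⟩ := IsAlgClosed.exists_pow_nat_eq (β ^ 2 - γ * α) (n := 2) two_pos
    have hs0 : s ≠ 0 := by
      rintro rfl
      exact hne (by linear_combination -hs)
    -- With s ≠ 0, the signs ±s give two singular points besides the origin, hence three in all.
    have key : ∀ t : ℂ, t ^ 2 = s ^ 2 → ![-α / 2, (-β + t) / 2] = P ∨ ![-α / 2, (-β + t) / 2] = Q := by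
      intro t ht
      have : ![-α / 2, (-β + t) / 2] ∈
          critSet (degenerateMap ![1, 0, 0] ![0, 1, 0] ![0, 0, 1] ![α, β, γ] 0) := by
        rw [hmem]
        refine ⟨?_, ?_, ?_⟩
        · simp; right; ring
        · simp; right; ring
        · simp
          linear_combination (ht + hs) / 2
      simpa [hS] using this
    have hz : (0 : Fin 2 → ℂ) = P ∨ (0 : Fin 2 → ℂ) = Q := by
      have : (0 : Fin 2 → ℂ) ∈
          critSet (degenerateMap ![1, 0, 0] ![0, 1, 0] ![0, 0, 1] ![α, β, γ] 0) := by
        rw [hmem]; simp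
      simpa [hS] using this
    have k1 := key s rfl
    have k2 := key (-s) (by ring)
    have n1 : ∀ t : ℂ, ![-α / 2, (-β + t) / 2] ≠ (0 : Fin 2 → ℂ) := fun t h => by
      simpa [hα] using congrFun h 0
    have n2 : ![-α / 2, (-β + s) / 2] ≠ ![-α / 2, (-β + -s) / 2] := fun h => by
      have := congrFun h 1
      simp at this
      exact hs0 (by linear_combination this / 2)
    have n3 := n1 s
    have n4 := n1 (-s)
    generalize ![-α / 2, (-β + s) / 2] = A at *
    generalize ![-α / 2, (-β + -s) / 2] = B at *
    rcases k1 with rfl | rfl <;> rcases k2 with rfl | rfl <;> rcases hz with h | h <;> simp_all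

theorem normalForm_mem_orbit_of_ncard_eq_two {F : Triple} (hF : F ∈ Omega)
    (h : (criticalSet F).ncard = 2) : normalForm ∈ orbit F := by
  rw [criticalSet_eq_critSet hF] at h
  obtain ⟨q, hq⟩ : (critSet (toMap F)).Nonempty := Set.nonempty_of_ncard_ne_zero (by omega)
  obtain ⟨v, hv, hqv⟩ := hq
  obtain ⟨w, hw⟩ : ∃ w : Fin 2 → ℂ, w 0 * v 1 - v 0 * w 1 ≠ 0 := by
    by_contra! hc
    have h0 := hc ![0, 1]
    have h1 := hc ![1, 0]
    simp at h0 h1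
    exact hv (by ext i; fin_cases i; exacts [h0, h1])
  have hz : toMap F = toMap (ofCoeffVec (coeffVec F)) := by rw [ofCoeffVec_coeffVec hF]
  generalize coeffVec F = z at hz
  have hqv' : ∀ i, z (i, 0) * (2 * q 0 * v 0) + z (i, 1) * (q 0 * v 1 + q 1 * v 0) +
      z (i, 2) * (2 * q 1 * v 1) + z (i, 3) * v 0 + z (i, 4) * v 1 = 0 := by
    intro i
    have := congrFun hqv i
    rw [hz, toMap_ofCoeffVec, toMap_ofCoeffVec] at this
    simp only [Pi.add_apply, Pi.sub_apply] at this
    linear_combination this / 2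
  have hdetR : (Matrix.of ![![w 0, v 0], ![w 1, v 1]]).det ≠ 0 := by
    rw [Matrix.det_fin_two]; simpa using hw
  -- R sends the origin to q and the second basis vector to the kernel direction v, so no linear
  -- term in y remains.
  set R := affineOfMatrix _ hdetR q with hR
  set A₁ : Fin 3 → ℂ := fun i => z (i, 0) * w 0 ^ 2 + z (i, 1) * w 0 * w 1 + z (i, 2) * w 1 ^ 2 with hA₁
  set A₂ : Fin 3 → ℂ := fun i => 2 * z (i, 0) * w 0 * v 0 + z (i, 1) * (w 0 * v 1 + w 1 * v 0) +
    2 * z (i, 2) * w 1 * v 1 with hA₂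
  set A₃ : Fin 3 → ℂ := fun i => z (i, 0) * v 0 ^ 2 + z (i, 1) * v 0 * v 1 + z (i, 2) * v 1 ^ 2 with hA₃
  set u : Fin 3 → ℂ := fun i => z (i, 0) * (2 * q 0 * w 0) + z (i, 1) * (q 0 * w 1 + q 1 * w 0) +
      z (i, 2) * (2 * q 1 * w 1) + z (i, 3) * w 0 + z (i, 4) * w 1 with hu
  have hFR : ∀ p, toMap F (R p) = degenerateMap A₁ A₂ A₃ u (toMap F q) p := by
    intro p
    ext i
    rw [hz, toMap_ofCoeffVec, degenerateMap]
    simp only [Pi.add_apply, Pi.smul_apply, smul_eq_mul, toMap_ofCoeffVec, hR,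
      affineOfMatrix_apply, hA₁, hA₂, hA₃, hu]
    simp [Matrix.mulVec, dotProduct, Fin.sum_univ_two]
    linear_combination p 1 * hqv' i
  have hcard : (critSet (degenerateMap A₁ A₂ A₃ u (toMap F q))).ncard = 2 := by
    have e := (ncard_critSet_comp (toMap F) (AffineEquiv.refl ℂ _) R).trans h
    simpa only [hFR, AffineEquiv.refl_apply] using e
  set A : Matrix (Fin 3) (Fin 3) ℂ := Matrix.of fun i j => ![A₁ i, A₂ i, A₃ i] j with hA
  by_cases hdet : A.det = 0
  · obtain ⟨l, hl, hlA⟩ := Matrix.exists_vecMul_eq_zero_iff.mpr hdet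
    refine absurd hcard (ncard_critSet_ne_two_of_dependent hl ?_ ?_ ?_)
    · simpa [Matrix.vecMul, dotProduct, Fin.sum_univ_three, hA] using congrFun hlA 0
    · simpa [Matrix.vecMul, dotProduct, Fin.sum_univ_three, hA] using congrFun hlA 1
    · simpa [Matrix.vecMul, dotProduct, Fin.sum_univ_three, hA] using congrFun hlA 2
  have hunit : IsUnit A.det := Ne.isUnit hdet
  have hdet' : A⁻¹.det ≠ 0 := by
    rw [Matrix.det_nonsing_inv]
    simpa using hdet
  set L := affineOfMatrix A⁻¹ hdet' (-(A⁻¹.mulVec (toMap F q))) with hL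
  obtain ⟨α, β, γ, hm⟩ : ∃ α β γ : ℂ, A⁻¹.mulVec u = ![α, β, γ] :=
    ⟨_, _, _, by ext i; fin_cases i <;> rfl⟩
  have hLF : ∀ p, L (toMap F (R p)) =
      degenerateMap ![1, 0, 0] ![0, 1, 0] ![0, 0, 1] ![α, β, γ] 0 p := by
    intro p
    have e : degenerateMap A₁ A₂ A₃ u (toMap F q) p =
        A.mulVec ![p 0 ^ 2, p 0 * p 1, p 1 ^ 2] + p 0 • u + toMap F q := by
      ext i
      simp [degenerateMap, hA]
      ring
    rw [hL, affineOfMatrix_apply, hFR, e, Matrix.mulVec_add, Matrix.mulVec_add, Matrix.mulVec_mulVec,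
      Matrix.nonsing_inv_mul _ hunit, Matrix.one_mulVec, Matrix.mulVec_smul, hm,
      add_neg_cancel_right]
    ext i
    fin_cases i <;> simp [degenerateMap]
  have hcard' : (critSet (degenerateMap ![1, 0, 0] ![0, 1, 0] ![0, 0, 1] ![α, β, γ] 0)).ncard = 2 := by
    have e := (ncard_critSet_comp (toMap F) L R).trans h
    simpa only [hLF] using e
  rcases conditions_of_ncard_critSet_eq_two hcard' with ⟨rfl, hβ⟩ | ⟨hα, hβγ⟩
  -- The normal form has singular points (0, 0) and (-1/2, 0); the source change sends them to (0,
  -- -β) and (0, 0).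
  · have h1 : (Matrix.of ![![0, 1], ![-2 * β, γ / (2 * β)]]).det ≠ 0 := by
      rw [Matrix.det_fin_two]; simpa using hβ
    have h2 : (Matrix.of ![![γ ^ 2 / (16 * β ^ 4), -γ / (4 * β ^ 3), 1 / (4 * β ^ 2)],
        ![γ / (4 * β ^ 2), -1 / (2 * β), 0], ![1, 0, 0]]).det ≠ 0 := by
      rw [Matrix.det_fin_three]; simp [hβ]
    refine normalForm_mem_orbit (L.trans (affineOfMatrix _ h2 ![-1 / 4, 0, 0]))
      ((affineOfMatrix _ h1 ![0, -β]).trans R) fun p => ?_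
    simp only [AffineEquiv.trans_apply, hLF]
    ext i
    fin_cases i <;>
      simp [affineOfMatrix_apply, degenerateMap, dotProduct, Fin.sum_univ_two] <;> field_simp <;> ring
  -- Here the origin is fixed and (-1/2, 0) goes to the other singular point (-α/2, -β/2).
  · have h1 : (Matrix.of ![![α, 0], ![β, 1]]).det ≠ 0 := by
      rw [Matrix.det_fin_two]; simpa using hα
    have h2 : (Matrix.of ![![1 / α ^ 2, 0, 0], ![-β / α ^ 2, 1 / α, 0],
        ![β ^ 2 / α ^ 2, -2 * β / α, 1]]).det ≠ 0 := by
      rw [Matrix.det_fin_three]; simp [hα]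
    refine normalForm_mem_orbit (L.trans (affineOfMatrix _ h2 0))
      ((affineOfMatrix _ h1 0).trans R) fun p => ?_
    have hγ : γ = β ^ 2 / α := by field_simp; linear_combination -hβγ
    simp only [AffineEquiv.trans_apply, hLF, hγ]
    ext i
    fin_cases i <;>
      simp [affineOfMatrix_apply, degenerateMap, dotProduct, Fin.sum_univ_two] <;> field_simp <;> ring


/-! ### Maps with independent quadratic parts: critical points as roots of a cubic -/

/-- The map `(x², xy, y²) + M (x, y)`. -/
def monicMap (M : Matrix (Fin 3) (Fin 2) ℂ) (p : Fin 2 → ℂ) : Fin 3 → ℂ :=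
  ![p 0 ^ 2, p 0 * p 1, p 1 ^ 2] + M.mulVec p

/-- The coefficient of `t²` in the critical cubic. -/
def cubicB {R : Type*} [CommRing R] (M : Matrix (Fin 3) (Fin 2) R) : R := 2 * M 1 1 - M 0 0

/-- The coefficient of `t` in the critical cubic. -/
def cubicC {R : Type*} [CommRing R] (M : Matrix (Fin 3) (Fin 2) R) : R :=
  -(M 0 1 * (2 * M 1 0 - M 2 1))

/-- The constant coefficient of the critical cubic. -/
def cubicE {R : Type*} [CommRing R] (M : Matrix (Fin 3) (Fin 2) R) : R := -(M 0 1 ^ 2 * M 2 0)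

theorem mem_critSet_monicMap {M : Matrix (Fin 3) (Fin 2) ℂ} {p : Fin 2 → ℂ} :
    p ∈ critSet (monicMap M) ↔
      (p 1 + M 1 0) * (2 * p 1 + M 2 1) - (p 0 + M 1 1) * M 2 0 = 0 ∧
      M 2 0 * M 0 1 - (2 * p 1 + M 2 1) * (2 * p 0 + M 0 0) = 0 ∧
      (2 * p 0 + M 0 0) * (p 0 + M 1 1) - M 0 1 * (p 1 + M 1 0) = 0 := by
  have h := exists_kernel_iff_minors ![2 * p 0 + M 0 0, p 1 + M 1 0, M 2 0]
    ![M 0 1, p 0 + M 1 1, 2 * p 1 + M 2 1]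
  simp only [Matrix.cons_val] at h
  rw [← h]
  refine exists_congr fun v => and_congr_right fun _ => ?_
  rw [funext_iff]
  refine forall_congr' fun i => ?_
  simp only [monicMap, Matrix.mulVec, dotProduct, Fin.sum_univ_two, Pi.add_apply, Pi.sub_apply]
  constructor
  · intro h
    fin_cases i <;> simp at h ⊢ <;> linear_combination h / 2
  · intro h
    fin_cases i <;> simp at h ⊢ <;> linear_combination 2 * h

/-- With t = 2x + M₀₀, one minor gives y as a quadratic in t because M₀₁ ≠ 0; a second minor becomes
the cubic, and M₀₁ times the third is a combination of these two. -/
theorem critSet_monicMap {M : Matrix (Fin 3) (Fin 2) ℂ} (hM : M 0 1 ≠ 0) :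
    critSet (monicMap M) = (fun t : ℂ => ![(t - M 0 0) / 2,
      t * (t + cubicB M) / (2 * M 0 1) - M 1 0]) ''
        {t | t ^ 3 + cubicB M * t ^ 2 + cubicC M * t + cubicE M = 0} := by
  ext p
  rw [mem_critSet_monicMap]
  simp only [Set.mem_image, Set.mem_ofPred_eq]
  constructor
  · rintro ⟨-, h1, h2⟩
    refine ⟨2 * p 0 + M 0 0, ?_, ?_⟩
    · simp only [cubicB, cubicC, cubicE]
      linear_combination 2 * (2 * p 0 + M 0 0) * h2 - M 0 1 * h1
    · ext i
      fin_cases i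
      · simp
      · simp [cubicB]
        field_simp
        linear_combination h2
  · rintro ⟨t, ht, rfl⟩
    obtain ⟨y, hy⟩ : ∃ y, y = t * (t + cubicB M) / (2 * M 0 1) - M 1 0 := ⟨_, rfl⟩
    rw [← hy]
    have hy' : t * (t + cubicB M) - 2 * M 0 1 * (y + M 1 0) = 0 := by
      rw [hy]; field_simp; ring
    have h1 : M 2 0 * M 0 1 - (2 * y + M 2 1) * t = 0 := by
      refine (mul_eq_zero.mp ?_).resolve_left hM
      simp only [cubicB, cubicC, cubicE] at ht hy'
      linear_combination t * hy' - ht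
    simp only [Matrix.cons_val]
    refine ⟨?_, by linear_combination h1, ?_⟩
    · refine (mul_eq_zero.mp ?_).resolve_left hM
      simp only [cubicB] at hy'
      linear_combination (-1 / 2) * (2 * y + M 2 1) * hy' - (t + 2 * M 1 1 - M 0 0) / 2 * h1
    · simp only [cubicB] at hy'
      linear_combination hy' / 2

theorem exists_cubic_roots (B C E : ℂ) : ∃ r s t : ℂ, B = -(r + s + t) ∧
    C = r * s + s * t + t * r ∧ E = -(r * s * t) := by
  obtain ⟨r, hr⟩ : ∃ r : ℂ, r ^ 3 + B * r ^ 2 + C * r + E = 0 := by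
    have hdeg : (Polynomial.X ^ 3 + (Polynomial.C B * Polynomial.X ^ 2 + Polynomial.C C *
        Polynomial.X + Polynomial.C E) : Polynomial ℂ).degree = 3 := by
      compute_degree!
    obtain ⟨r, hr⟩ := IsAlgClosed.exists_root (Polynomial.X ^ 3 + (Polynomial.C B *
      Polynomial.X ^ 2 + Polynomial.C C * Polynomial.X + Polynomial.C E) : Polynomial ℂ)
      (by rw [hdeg]; norm_num)
    refine ⟨r, ?_⟩
    simp [Polynomial.IsRoot] at hr
    linear_combination hr
  obtain ⟨s, hs⟩ := exists_quadratic_root one_ne_zero (B + r) (C + r * (B + r))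
  exact ⟨r, s, -B - r - s, by ring, by linear_combination hs, by linear_combination hr - r * hs⟩

theorem ncard_cubic_roots_eq_two_iff (B C E : ℂ) :
    {t : ℂ | t ^ 3 + B * t ^ 2 + C * t + E = 0}.ncard = 2 ↔
      ∃ s w : ℂ, s ≠ w ∧ B = -(2 * s + w) ∧ C = s ^ 2 + 2 * s * w ∧ E = -(s ^ 2 * w) := by
  constructor
  · intro h
    obtain ⟨r, s, t, rfl, rfl, rfl⟩ := exists_cubic_roots B C E
    have hset : {x : ℂ | x ^ 3 + -(r + s + t) * x ^ 2 + (r * s + s * t + t * r) * x +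
        -(r * s * t) = 0} = {r, s, t} := by
      ext x
      have : x ^ 3 + -(r + s + t) * x ^ 2 + (r * s + s * t + t * r) * x + -(r * s * t) =
        (x - r) * ((x - s) * (x - t)) := by ring
      simp only [Set.mem_ofPred_eq, this]
      simp [sub_eq_zero]
    rw [hset] at h
    by_cases hrs : r = s
    · subst hrs
      refine ⟨r, t, ?_, by ring, by ring, by ring⟩
      rintro rfl
      simp at h
    by_cases hst : s = t
    · subst hst
      exact ⟨s, r, Ne.symm hrs, by ring, by ring, by ring⟩
    by_cases hrt : r = t
    · subst hrt
      exact ⟨r, s, hrs, by ring, by ring, by ring⟩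
    rw [Set.ncard_eq_three.mpr ⟨r, s, t, hrs, hrt, hst, rfl⟩] at h
    omega
  · rintro ⟨s, w, hsw, rfl, rfl, rfl⟩
    have hset : {x : ℂ | x ^ 3 + -(2 * s + w) * x ^ 2 + (s ^ 2 + 2 * s * w) * x +
        -(s ^ 2 * w) = 0} = {s, w} := by
      ext x
      have : x ^ 3 + -(2 * s + w) * x ^ 2 + (s ^ 2 + 2 * s * w) * x + -(s ^ 2 * w) =
        (x - s) ^ 2 * (x - w) := by ring
      simp only [Set.mem_ofPred_eq, this]
      simp [sub_eq_zero]
    rw [hset, Set.ncard_pair hsw]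

theorem ncard_critSet_monicMap_eq_two_iff {M : Matrix (Fin 3) (Fin 2) ℂ} (hM : M 0 1 ≠ 0) :
    (critSet (monicMap M)).ncard = 2 ↔ ∃ s w : ℂ, s ≠ w ∧ cubicB M = -(2 * s + w) ∧
      cubicC M = s ^ 2 + 2 * s * w ∧ cubicE M = -(s ^ 2 * w) := by
  rw [critSet_monicMap hM, Set.ncard_image_of_injective, ncard_cubic_roots_eq_two_iff]
  intro t t' h
  have := congrFun h 0
  simpa using this

/-! ### The family -/

theorem family_mem_Omega (a b : ℂ) : family a b ∈ Omega := by
  have : family a b = ofCoeffVec fun ij => ![![1, 0, 0, 0, 1, 0], ![0, 0, 1, 1, 0, 0],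
      ![0, 1, 0, a, b, 0]] ij.1 ij.2 := by
    funext i
    fin_cases i <;> simp [family, ofCoeffVec, ofCoeff_eq]
  rw [this]
  exact ofCoeffVec_mem_Omega _

/-- The two maps differ only in the order of their components. -/
theorem critSet_family (a b : ℂ) :
    critSet (toMap (family a b)) = critSet (monicMap (Matrix.of ![![0, 1], ![a, b], ![1, 0]])) := by
  ext p
  refine exists_congr fun v => and_congr_right fun _ => ?_
  simp only [funext_iff, Fin.forall_fin_succ, toMap, family, monicMap, Matrix.mulVec, dotProduct,
    Fin.sum_univ_two, Pi.add_apply, Pi.sub_apply]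
  simp [add_assoc]
  tauto

theorem ncard_criticalSet_family {a b : ℂ}
    (h : 2 * a ^ 3 + a ^ 2 * b ^ 2 + 9 / 2 * a * b + 2 * b ^ 3 - 27 / 16 = 0)
    (hab : ∀ ε : ℂ, ε ^ 3 = 1 → (a, b) ≠ (-(3 / 2) * ε, -(3 / 2) * ε ^ 2)) :
    (criticalSet (family a b)).ncard = 2 := by
  rw [criticalSet_eq_critSet (family_mem_Omega a b), critSet_family,
    ncard_critSet_monicMap_eq_two_iff (by simp)]
  simp only [cubicB, cubicC, cubicE, Matrix.of_apply, Matrix.cons_val]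
  -- The cubic is t³ + 2bt² - 2at - 1. A triple root s has s³ = 1, a = -3s²/2 and b = -3s/2, which
  -- is the pair excluded for ε = s².
  have key : ∀ s w : ℂ, 2 * b - 0 = -(2 * s + w) → -(1 * (2 * a - 0)) = s ^ 2 + 2 * s * w →
      -(1 ^ 2 * 1) = -(s ^ 2 * w) → ∃ s w : ℂ, s ≠ w ∧ 2 * b - 0 = -(2 * s + w) ∧
      -(1 * (2 * a - 0)) = s ^ 2 + 2 * s * w ∧ -(1 ^ 2 * 1) = -(s ^ 2 * w) := by
    intro s w h1 h2 h3
    refine ⟨s, w, ?_, h1, h2, h3⟩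
    rintro rfl
    have hs : s ^ 3 = 1 := by linear_combination h3
    refine hab (s ^ 2) (by linear_combination (s ^ 3 + 1) * hs) (Prod.ext ?_ ?_)
    · simp only
      linear_combination -h2 / 2
    · simp only
      linear_combination h1 / 2 + 3 / 2 * s * hs
  obtain ⟨r, s, t, h1, h2, h3⟩ := exists_cubic_roots (2 * b - 0) (-(1 * (2 * a - 0))) (-(1 ^ 2 * 1))
  -- The discriminant is 16 times the left side of `h`, once rst = 1 is used.
  have hdisc : ((r - s) * ((s - t) * (t - r))) ^ 2 = 0 := by
    have hb : b = -(r + s + t) / 2 := by linear_combination h1 / 2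
    have ha : a = -(r * s + s * t + t * r) / 2 := by linear_combination -h2 / 2
    rw [ha, hb] at h
    have h3' : r * s * t = 1 := by linear_combination h3
    linear_combination 16 * h + (-4 * (r + s + t) ^ 3 + 18 * (r + s + t) *
      (r * s + s * t + t * r) - 27 * (r * s * t + 1)) * h3'
  have hdisc' := pow_eq_zero_iff two_ne_zero |>.mp hdisc
  rcases mul_eq_zero.mp hdisc' with h0 | h0
  · obtain rfl := sub_eq_zero.mp h0
    exact key r t (by rw [h1]; ring) (by rw [h2]; ring) (by rw [h3]; ring)
  · rcases mul_eq_zero.mp h0 with h0 | h0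
    · obtain rfl := sub_eq_zero.mp h0
      exact key s r (by rw [h1]; ring) (by rw [h2]; ring) (by rw [h3]; ring)
    · obtain rfl := sub_eq_zero.mp h0
      exact key t s (by rw [h1]; ring) (by rw [h2]; ring) (by rw [h3]; ring)


/-! ### The dimension of the set of maps with two critical points -/

/-- The matrix of coefficients of `x², xy, y²`. -/
def quadMat {R : Type*} (z : Fin 3 × Fin 6 → R) : Matrix (Fin 3) (Fin 3) R :=
  Matrix.of fun i j => z (i, ![0, 1, 2] j)

/-- The matrix of coefficients of `x, y`. -/
def linMat {R : Type*} (z : Fin 3 × Fin 6 → R) : Matrix (Fin 3) (Fin 2) R :=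
  Matrix.of fun i j => z (i, ![3, 4] j)

/-- The linear coefficients relative to the quadratic ones, with denominators cleared. -/
def adjLin {R : Type*} [CommRing R] (z : Fin 3 × Fin 6 → R) : Matrix (Fin 3) (Fin 2) R :=
  (quadMat z).adjugate * linMat z

theorem map_det_quadMat {R S : Type*} [CommRing R] [CommRing S] (f : R →+* S)
    (z : Fin 3 × Fin 6 → R) : f (quadMat z).det = (quadMat fun q => f (z q)).det := by
  rw [RingHom.map_det]; rfl

theorem map_adjLin {R S : Type*} [CommRing R] [CommRing S] (f : R →+* S)
    (z : Fin 3 × Fin 6 → R) (i : Fin 3) (j : Fin 2) :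
    f (adjLin z i j) = adjLin (fun q => f (z q)) i j := by
  have h : f.mapMatrix (quadMat z) = quadMat fun q => f (z q) := rfl
  have h' : (linMat z).map f = linMat fun q => f (z q) := rfl
  rw [adjLin, adjLin, ← h, ← h', ← RingHom.map_adjugate, RingHom.mapMatrix_apply, ← Matrix.map_mul]
  rfl

/-- Composing with the inverse of the quadratic part, after removing constants, yields a `monicMap`.
-/
theorem ncard_criticalSet_ofCoeffVec {z : Fin 3 × Fin 6 → ℂ} (hz : (quadMat z).det ≠ 0) :
    (criticalSet (ofCoeffVec z)).ncard =
      (critSet (monicMap ((quadMat z).det⁻¹ • adjLin z))).ncard := by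
  have hunit : IsUnit (quadMat z).det := hz.isUnit
  have hdet : (quadMat z)⁻¹.det ≠ 0 := by
    rw [Matrix.det_nonsing_inv]
    simpa using hz
  have hM : (quadMat z).det⁻¹ • adjLin z = (quadMat z)⁻¹ * linMat z := by
    rw [adjLin, Matrix.inv_def, Ring.inverse_eq_inv', Matrix.smul_mul]
  rw [criticalSet_eq_critSet (ofCoeffVec_mem_Omega z), hM,
    ← ncard_critSet_comp (toMap (ofCoeffVec z)) (affineOfMatrix _ hdet
      (-((quadMat z)⁻¹.mulVec fun i => z (i, 5)))) (AffineEquiv.refl ℂ _)]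
  congr 2
  funext p
  have e : toMap (ofCoeffVec z) p = (quadMat z).mulVec ![p 0 ^ 2, p 0 * p 1, p 1 ^ 2] +
      (linMat z).mulVec p + fun i => z (i, 5) := by
    ext i
    rw [toMap_ofCoeffVec]
    simp only [Matrix.mulVec, dotProduct, Fin.sum_univ_three, Fin.sum_univ_two, quadMat, linMat,
      Pi.add_apply, Matrix.of_apply, Matrix.cons_val]
    ring
  rw [AffineEquiv.refl_apply, affineOfMatrix_apply, e, Matrix.mulVec_add, Matrix.mulVec_add,
    Matrix.mulVec_mulVec, Matrix.nonsing_inv_mul _ hunit, Matrix.one_mulVec,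
    Matrix.mulVec_mulVec, add_neg_cancel_right, monicMap]

/-- The discriminant of the critical cubic. -/
def cubicDisc {R : Type*} [CommRing R] (M : Matrix (Fin 3) (Fin 2) R) : R :=
  cubicB M ^ 2 * cubicC M ^ 2 - 4 * cubicC M ^ 3 - 4 * cubicB M ^ 3 * cubicE M +
    18 * cubicB M * cubicC M * cubicE M - 27 * cubicE M ^ 2

/-- The cubic's coefficients are homogeneous of degrees 1, 2, 3 in M, so the discriminant has weight
6 and the denominator det can be cleared. -/
theorem cubicDisc_smul (c : ℂ) (M : Matrix (Fin 3) (Fin 2) ℂ) :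
    cubicDisc (c • M) = c ^ 6 * cubicDisc M := by
  simp only [cubicDisc, cubicB, cubicC, cubicE, Matrix.smul_apply, smul_eq_mul]
  ring

theorem map_cubicDisc_adjLin {R S : Type*} [CommRing R] [CommRing S] (f : R →+* S)
    (z : Fin 3 × Fin 6 → R) : f (cubicDisc (adjLin z)) = cubicDisc (adjLin fun q => f (z q)) := by
  simp only [cubicDisc, cubicB, cubicC, cubicE, map_sub, map_add, map_mul, map_pow, map_neg,
    map_ofNat, map_adjLin]

theorem aeval_apply_eq_eval {σ : Type*} (z : σ → ℂ) (p : MvPolynomial σ ℂ) :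
    aeval z p = eval z p := by
  rw [← coe_aeval_eq_eval]; rfl

/-- The factors det and M₀₁ absorb the maps to which the cubic does not apply; for the dimension
bound any nonzero equation suffices. -/
theorem relation_of_ncard_eq_two {z : Fin 3 × Fin 6 → ℂ}
    (h : (criticalSet (ofCoeffVec z)).ncard = 2) :
    (quadMat z).det * adjLin z 0 1 * cubicDisc (adjLin z) = 0 := by
  by_cases hz : (quadMat z).det = 0
  · simp [hz]
  by_cases hp : adjLin z 0 1 = 0
  · simp [hp]
  rw [ncard_criticalSet_ofCoeffVec hz, ncard_critSet_monicMap_eq_two_iff (by simp [hz, hp])] at h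
  obtain ⟨s, w, -, hB, hC, hE⟩ := h
  have hdisc : cubicDisc ((quadMat z).det⁻¹ • adjLin z) = 0 := by
    rw [cubicDisc, hB, hC, hE]; ring
  rw [cubicDisc_smul] at hdisc
  rw [(mul_eq_zero.mp hdisc).resolve_left (by simp [hz]), mul_zero]

/-- The equation `det A · p · Δ` satisfied by all maps with two critical points. -/
def discEquation : MvPolynomial (Fin 3 × Fin 6) ℂ :=
  (quadMat X).det * adjLin X 0 1 * cubicDisc (adjLin X)

theorem eval_discEquation (z : Fin 3 × Fin 6 → ℂ) :
    eval z discEquation = (quadMat z).det * adjLin z 0 1 * cubicDisc (adjLin z) := by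
  simp only [discEquation, map_mul, map_det_quadMat, map_adjLin, map_cubicDisc_adjLin, eval_X]

/-- The coefficients of `(x², xy, y²) + M (x, y)`. -/
def monicCoeff {R : Type*} [CommRing R] (M : Matrix (Fin 3) (Fin 2) R) (q : Fin 3 × Fin 6) : R :=
  ![![1, 0, 0, M 0 0, M 0 1, 0], ![0, 1, 0, M 1 0, M 1 1, 0], ![0, 0, 1, M 2 0, M 2 1, 0]] q.1 q.2

theorem quadMat_monicCoeff {R : Type*} [CommRing R] (M : Matrix (Fin 3) (Fin 2) R) :
    quadMat (monicCoeff M) = 1 := by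
  ext i j
  fin_cases i <;> fin_cases j <;> simp [quadMat, monicCoeff]

theorem adjLin_monicCoeff {R : Type*} [CommRing R] (M : Matrix (Fin 3) (Fin 2) R) :
    adjLin (monicCoeff M) = M := by
  rw [adjLin, quadMat_monicCoeff, Matrix.adjugate_one, Matrix.one_mul]
  ext i j
  fin_cases i <;> fin_cases j <;> simp [linMat, monicCoeff]

theorem discEquation_ne_zero : discEquation ≠ 0 := by
  intro h
  -- For this matrix the cubic is t³ - 1, with discriminant -27.
  have h1 := eval_discEquation (monicCoeff (Matrix.of ![![0, 1], ![0, 0], ![1, 0]]))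
  rw [h, quadMat_monicCoeff, adjLin_monicCoeff] at h1
  simp [cubicDisc, cubicB, cubicC, cubicE] at h1

/-- The set of quadratic maps with exactly two critical points. -/
def twoCritical : Set Triple := {F | F ∈ Omega ∧ (criticalSet F).ncard = 2}

theorem mem_coeffVec_image_iff (z : Fin 3 × Fin 6 → ℂ) :
    z ∈ coeffVec '' twoCritical ↔ (criticalSet (ofCoeffVec z)).ncard = 2 := by
  constructor
  · rintro ⟨F, ⟨hF, h⟩, rfl⟩
    rwa [ofCoeffVec_coeffVec hF]
  · exact fun h => ⟨_, ⟨ofCoeffVec_mem_Omega z, h⟩, coeffVec_ofCoeffVec z⟩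

theorem dimension_twoCritical_le : dimension twoCritical ≤ 17 := by
  have hmem : Ideal.Quotient.mk (vanishingIdeal ℂ (coeffVec '' twoCritical)) discEquation = 0 := by
    rw [Ideal.Quotient.eq_zero_iff_mem, mem_vanishingIdeal_iff]
    intro z hz
    rw [aeval_apply_eq_eval, eval_discEquation]
    exact relation_of_ncard_eq_two ((mem_coeffVec_image_iff z).mp hz)
  -- Killing a nonzerodivisor lowers the dimension of the 18-variable polynomial ring by at least
  -- one.
  have h := ringKrullDim_succ_le_of_surjective
    (Ideal.Quotient.mk (vanishingIdeal ℂ (coeffVec '' twoCritical)))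
    Ideal.Quotient.mk_surjective (mem_nonZeroDivisors_of_ne_zero discEquation_ne_zero) hmem
  rw [MvPolynomial.ringKrullDim_of_isNoetherianRing, ringKrullDim_eq_zero_of_field, zero_add] at h
  have h18 : ((Nat.card (Fin 3 × Fin 6) : ℕ) : WithBot ℕ∞) = 17 + 1 := by
    simp; norm_num
  rw [h18] at h
  exact (ENat.WithBot.add_le_add_one_right_iff).mp h

/-- The coefficients of the map with quadratic part and constant terms those of `z`, and whose
value of `adjLin` is prescribed by the linear terms of `z`. -/
def recoverCoeff (z : Fin 3 × Fin 6 → ℂ) (q : Fin 3 × Fin 6) : ℂ :=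
  ![z (q.1, 0), z (q.1, 1), z (q.1, 2), ((quadMat z).det⁻¹ • (quadMat z * linMat z)) q.1 0,
    ((quadMat z).det⁻¹ • (quadMat z * linMat z)) q.1 1, z (q.1, 5)] q.2

theorem quadMat_recoverCoeff (z : Fin 3 × Fin 6 → ℂ) : quadMat (recoverCoeff z) = quadMat z := by
  ext i j
  fin_cases j <;> simp [quadMat, recoverCoeff]

theorem adjLin_recoverCoeff {z : Fin 3 × Fin 6 → ℂ} (hz : (quadMat z).det ≠ 0) :
    adjLin (recoverCoeff z) = linMat z := by
  have h : linMat (recoverCoeff z) = (quadMat z).det⁻¹ • (quadMat z * linMat z) := by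
    ext i j
    fin_cases j <;> simp [linMat, recoverCoeff]
  rw [adjLin, quadMat_recoverCoeff, h, Matrix.mul_smul, ← Matrix.mul_assoc, Matrix.adjugate_mul,
    Matrix.smul_mul, Matrix.one_mul, smul_smul, inv_mul_cancel₀ hz, one_smul]

/-- The functions used as coordinates on the set of maps with two critical points. -/
def coordinate (q : Fin 3 × Fin 6) : MvPolynomial (Fin 3 × Fin 6) ℂ :=
  ![X (q.1, 0), X (q.1, 1), X (q.1, 2), adjLin X q.1 0, adjLin X q.1 1, X (q.1, 5)] q.2

theorem eval_coordinate_recoverCoeff {z : Fin 3 × Fin 6 → ℂ} (hz : (quadMat z).det ≠ 0)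
    (q : Fin 3 × Fin 6) : eval (recoverCoeff z) (coordinate q) = z q := by
  obtain ⟨i, j⟩ := q
  fin_cases j <;>
    simp [coordinate, map_adjLin, adjLin_recoverCoeff hz] <;> simp [recoverCoeff, linMat]

/-- The genericity condition: the critical cubic has no forced triple root. -/
def generic : MvPolynomial (Fin 3 × Fin 6) ℂ :=
  (quadMat X).det * X (0, 4) * (cubicB (linMat X) ^ 2 - 3 * cubicC (linMat X))

theorem eval_generic (z : Fin 3 × Fin 6 → ℂ) : eval z generic =
    (quadMat z).det * z (0, 4) * (cubicB (linMat z) ^ 2 - 3 * cubicC (linMat z)) := by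
  simp [generic, map_det_quadMat, cubicB, cubicC, linMat]

theorem generic_ne_zero : generic ≠ 0 := by
  intro h
  have h1 := eval_generic (monicCoeff (Matrix.of ![![1, 1], ![0, 0], ![0, 0]]))
  rw [h, quadMat_monicCoeff] at h1
  simp [cubicB, cubicC, linMat, monicCoeff] at h1

/-- Only the constant term of the cubic involves the entry (2, 0) of the linear matrix, that is z
(2, 3), so this single coordinate can be adjusted to force a double root. -/
theorem exists_update_mem_twoCritical {z : Fin 3 × Fin 6 → ℂ} (hz : eval z generic ≠ 0) :
    ∃ r : ℂ, recoverCoeff (Function.update z (2, 3) r) ∈ coeffVec '' twoCritical := by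
  rw [eval_generic] at hz
  have hD : (quadMat z).det ≠ 0 := left_ne_zero_of_mul (left_ne_zero_of_mul hz)
  have hp : z (0, 4) ≠ 0 := right_ne_zero_of_mul (left_ne_zero_of_mul hz)
  have hg := right_ne_zero_of_mul hz
  have hB : cubicB (linMat z) = 2 * z (1, 4) - z (0, 3) := rfl
  have hC : cubicC (linMat z) = -(z (0, 4) * (2 * z (1, 3) - z (2, 4))) := rfl
  generalize hb : cubicB (linMat z) = b at *
  generalize hc : cubicC (linMat z) = c at *
  -- s is a root of the derivative; the third root is -b - 2s, distinct from s because b² ≠ 3c.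
  obtain ⟨s, hs⟩ := exists_quadratic_root (three_ne_zero (α := ℂ)) (2 * b) c
  have hsw : s ≠ -b - 2 * s := fun h => hg (by
    have : b = -3 * s := by linear_combination h
    subst this
    linear_combination -3 * hs)
  refine ⟨s ^ 2 * (-b - 2 * s) / z (0, 4) ^ 2, ?_⟩
  have hQ : ∀ r, quadMat (Function.update z (2, 3) r) = quadMat z := by
    intro r
    ext i j
    fin_cases j <;> simp [quadMat]
  rw [mem_coeffVec_image_iff, ncard_criticalSet_ofCoeffVec (by rwa [quadMat_recoverCoeff, hQ]),
    quadMat_recoverCoeff, hQ, adjLin_recoverCoeff (by rwa [hQ]),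
    ncard_critSet_monicMap_eq_two_iff (by simp [linMat, hD, hp])]
  generalize (quadMat z).det = D at *
  refine ⟨D⁻¹ * s, D⁻¹ * (-b - 2 * s), fun h => hsw (mul_left_cancel₀ (inv_ne_zero hD) h), ?_, ?_, ?_⟩
  · simp [cubicB, linMat]
    linear_combination -D⁻¹ * hB
  · simp [cubicC, linMat]
    linear_combination -D⁻¹ ^ 2 * hC + D⁻¹ ^ 2 * hs
  · simp [cubicE, linMat]
    field_simp

/-- The 17 coordinates other than (2, 3) take arbitrary generic values on the set. A relation P
among them therefore vanishes wherever `generic` does not, so P · `generic` = 0 and P = 0. -/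
theorem le_dimension_twoCritical : 17 ≤ dimension twoCritical := by
  have hind : AlgebraicIndependent ℂ (fun q : {q : Fin 3 × Fin 6 // q ≠ (2, 3)} =>
      Ideal.Quotient.mkₐ ℂ (vanishingIdeal ℂ (coeffVec '' twoCritical)) (coordinate q)) := by
    rw [algebraicIndependent_iff]
    intro P hP
    have hP' : aeval (fun q : {q : Fin 3 × Fin 6 // q ≠ (2, 3)} => coordinate q) P ∈
        vanishingIdeal ℂ (coeffVec '' twoCritical) := by
      rw [← Ideal.Quotient.eq_zero_iff_mem, ← hP]
      exact DFunLike.congr_fun (comp_aeval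
        (fun q : {q : Fin 3 × Fin 6 // q ≠ (2, 3)} => coordinate q)
        (Ideal.Quotient.mkₐ ℂ (vanishingIdeal ℂ (coeffVec '' twoCritical)))) P
    have hzero : rename Subtype.val P * generic = 0 := by
      refine MvPolynomial.funext fun z => ?_
      rw [map_mul, map_zero]
      by_cases hz : eval z generic = 0
      · rw [hz, mul_zero]
      obtain ⟨r, hr⟩ := exists_update_mem_twoCritical hz
      have h := hP' _ hr
      have hD : (quadMat (Function.update z (2, 3) r)).det ≠ 0 := by
        have : quadMat (Function.update z (2, 3) r) = quadMat z := by
          ext i j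
          fin_cases j <;> simp [quadMat]
        rw [this]
        rw [eval_generic] at hz
        exact left_ne_zero_of_mul (left_ne_zero_of_mul hz)
      have he : eval z (rename Subtype.val P) = 0 := by
        rw [eval_rename, ← h, ← aeval_apply_eq_eval]
        have hc : z ∘ Subtype.val = fun q : {q : Fin 3 × Fin 6 // q ≠ (2, 3)} =>
            aeval (recoverCoeff (Function.update z (2, 3) r)) (coordinate q) := by
          funext q
          rw [aeval_apply_eq_eval, eval_coordinate_recoverCoeff hD, Function.update_of_ne q.2,
            Function.comp_apply]
        rw [hc]
        exact (DFunLike.congr_fun (comp_aeval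
          (fun q : {q : Fin 3 × Fin 6 // q ≠ (2, 3)} => coordinate q)
          (aeval (recoverCoeff (Function.update z (2, 3) r)))) P).symm
      rw [he, zero_mul]
    have := (mul_eq_zero.mp hzero).resolve_right generic_ne_zero
    exact rename_injective _ Subtype.val_injective (by rw [this, map_zero])
  have h := card_le_ringKrullDim_of_algebraicIndependent hind
  have hcard : Nat.card {q : Fin 3 × Fin 6 // q ≠ (2, 3)} = 17 := by
    rw [Nat.card_eq_fintype_card]; decide
  rw [hcard] at h
  exact_mod_cast h

theorem dimension_twoCritical : dimension twoCritical = 17 :=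
  le_antisymm dimension_twoCritical_le le_dimension_twoCritical


/-! ### Affine substitutions -/

theorem affineEquiv_linear_apply {n : ℕ} (A : (Fin n → ℂ) ≃ᵃ[ℂ] (Fin n → ℂ)) (x : Fin n → ℂ)
    (i : Fin n) : A.linear x i = ∑ j, A.linear (Pi.single j 1) i * x j := by
  have hx : A.linear x = ∑ j, x j • A.linear (Pi.single j 1) := by
    conv_lhs => rw [pi_eq_sum_univ' x]
    simp only [map_sum, map_smul]
  rw [hx, Finset.sum_apply]
  simp [mul_comm]

theorem affineEquiv_apply {n : ℕ} (A : (Fin n → ℂ) ≃ᵃ[ℂ] (Fin n → ℂ)) (x : Fin n → ℂ) (i : Fin n) :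
    A x i = ∑ j, A.linear (Pi.single j 1) i * x j + A 0 i := by
  have h : A x = A.linear x + A 0 := by
    have := A.map_vadd 0 x
    simpa using this
  rw [h, Pi.add_apply, affineEquiv_linear_apply]

/-- The components of an affine automorphism of the plane, as polynomials. -/
def affineCoord (R : (Fin 2 → ℂ) ≃ᵃ[ℂ] (Fin 2 → ℂ)) (i : Fin 2) : MvPolynomial (Fin 2) ℂ :=
  linePoly (R.linear (Pi.single 0 1) i) (R.linear (Pi.single 1 1) i) (R 0 i)

theorem eval_affineCoord (R : (Fin 2 → ℂ) ≃ᵃ[ℂ] (Fin 2 → ℂ)) (i : Fin 2) (p : Fin 2 → ℂ) :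
    eval p (affineCoord R i) = R p i := by
  rw [affineEquiv_apply R p i]
  simp [affineCoord, linePoly]

/-- Composition of polynomials with an affine automorphism of the plane. -/
def substAffine (R : (Fin 2 → ℂ) ≃ᵃ[ℂ] (Fin 2 → ℂ)) :
    MvPolynomial (Fin 2) ℂ →ₐ[ℂ] MvPolynomial (Fin 2) ℂ := aeval (affineCoord R)

theorem eval_substAffine (R : (Fin 2 → ℂ) ≃ᵃ[ℂ] (Fin 2 → ℂ)) (p : Fin 2 → ℂ)
    (f : MvPolynomial (Fin 2) ℂ) : eval p (substAffine R f) = eval (R p) f := by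
  have h := DFunLike.congr_fun (comp_aeval (affineCoord R) (aeval (S₁ := ℂ) p)) f
  simp only [AlgHom.comp_apply, aeval_apply_eq_eval] at h
  rw [substAffine, h]
  congr 2
  funext i
  exact eval_affineCoord R i p

theorem substAffine_substAffine_symm (R : (Fin 2 → ℂ) ≃ᵃ[ℂ] (Fin 2 → ℂ))
    (f : MvPolynomial (Fin 2) ℂ) : substAffine R (substAffine R.symm f) = f :=
  MvPolynomial.funext fun p => by simp [eval_substAffine]

theorem substAffine_symm_substAffine (R : (Fin 2 → ℂ) ≃ᵃ[ℂ] (Fin 2 → ℂ))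
    (f : MvPolynomial (Fin 2) ℂ) : substAffine R.symm (substAffine R f) = f :=
  MvPolynomial.funext fun p => by simp [eval_substAffine]

theorem substAffine_component {F G : Triple} {L : (Fin 3 → ℂ) ≃ᵃ[ℂ] (Fin 3 → ℂ)}
    {R : (Fin 2 → ℂ) ≃ᵃ[ℂ] (Fin 2 → ℂ)} (h : ∀ p, toMap G p = L (toMap F (R p))) (i : Fin 3) :
    substAffine R (F i) =
      ∑ j, C (L.symm.linear (Pi.single j 1) i) * G j + C (L.symm 0 i) := by
  refine MvPolynomial.funext fun p => ?_
  have h1 : toMap F (R p) = L.symm (toMap G p) := by rw [h, L.symm_apply_apply]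
  have h2 := congrFun h1 i
  rw [affineEquiv_apply] at h2
  rw [eval_substAffine]
  simpa [toMap] using h2

/-! ### Topological degree -/

theorem hasTopDegree_normalForm : HasTopDegree normalForm 1 := by
  refine ⟨X 0 * X 1, mul_ne_zero (X_ne_zero _) (X_ne_zero _), fun p hp => ?_⟩
  have : {q | toMap normalForm q = toMap normalForm p} = {p} := by
    ext q
    simp only [Set.mem_ofPred_eq, Set.mem_singleton_iff]
    refine ⟨fun h => ?_, fun h => by rw [h]⟩
    rw [toMap_normalForm, toMap_normalForm] at h
    have h0 := congrFun h 0
    have h1 := congrFun h 1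
    have h2 := congrFun h 2
    simp at h0 h1 h2 hp
    obtain ⟨hp0, hp1⟩ := hp
    -- The last two components fix q up to sign; then q₀² = p₀², and the first component gives q₀ =
    -- p₀.
    have hlin : p 1 * q 0 = p 0 * q 1 := by
      refine mul_left_cancel₀ hp1 ?_
      linear_combination q 1 * h1 - q 0 * h2
    have hq0 : q 0 = p 0 := by
      refine mul_left_cancel₀ (pow_ne_zero 2 hp1) ?_
      linear_combination p 1 ^ 2 * h0 - (p 1 * q 0 + p 0 * q 1) * hlin - p 0 ^ 2 * h2
    have hq1 : q 1 = p 1 := by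
      refine mul_left_cancel₀ hp0 ?_
      rw [hq0] at h1
      exact h1
    ext i
    fin_cases i
    exacts [hq0, hq1]
  rw [this, Set.encard_singleton]
  rfl

theorem HasTopDegree.of_mem_orbit {F G : Triple} {n : ℕ} (hF : HasTopDegree F n)
    (h : G ∈ orbit F) : HasTopDegree G n := by
  obtain ⟨-, L, R, h⟩ := h
  obtain ⟨f, hf, hfib⟩ := hF
  refine ⟨substAffine R f, fun h0 => hf ?_, fun p hp => ?_⟩
  · rw [← substAffine_symm_substAffine R f, h0, map_zero]
  · rw [eval_substAffine] at hp
    rw [← hfib _ hp]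
    have : {q | toMap G q = toMap G p} = R ⁻¹' {q | toMap F q = toMap F (R p)} := by
      ext q
      simp [h]
    rw [this]
    exact Set.encard_preimage_of_bijective R.bijective _

/-! ### The self-intersection set -/

theorem fibreIdeal_le (F : Triple) (p : Fin 2 → ℂ) : fibreIdeal F p ≤ vanishingIdeal ℂ {p} := by
  rw [fibreIdeal, Ideal.span_le]
  rintro _ ⟨i, rfl⟩
  rw [SetLike.mem_coe, mem_vanishingIdeal_singleton_iff, aeval_apply_eq_eval]
  simp

theorem component_mem_fibreIdeal (F : Triple) (p : Fin 2 → ℂ) (i : Fin 3) :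
    F i - C (eval p (F i)) ∈ fibreIdeal F p :=
  Ideal.subset_span ⟨i, rfl⟩

/-- Substituting R carries generators of one fibre ideal to linear combinations of those of the
other; the inclusion in the ideal of the point always holds. -/
theorem fibreIdeal_eq_of_orbit {F G : Triple} {L : (Fin 3 → ℂ) ≃ᵃ[ℂ] (Fin 3 → ℂ)}
    {R : (Fin 2 → ℂ) ≃ᵃ[ℂ] (Fin 2 → ℂ)} (h : ∀ p, toMap G p = L (toMap F (R p))) {p : Fin 2 → ℂ}
    (hp : fibreIdeal F (R p) = vanishingIdeal ℂ {R p}) :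
    fibreIdeal G p = vanishingIdeal ℂ {p} := by
  refine le_antisymm (fibreIdeal_le G p) fun f hf => ?_
  have hf' : substAffine R.symm f ∈ fibreIdeal F (R p) := by
    rw [hp, mem_vanishingIdeal_singleton_iff, aeval_apply_eq_eval, eval_substAffine,
      R.symm_apply_apply]
    rwa [mem_vanishingIdeal_singleton_iff, aeval_apply_eq_eval] at hf
  have hle : fibreIdeal F (R p) ≤ (fibreIdeal G p).comap (substAffine R) := by
    rw [fibreIdeal, Ideal.span_le]
    rintro _ ⟨i, rfl⟩
    rw [SetLike.mem_coe, Ideal.mem_comap]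
    have e : substAffine R (F i - C (eval (R p) (F i))) =
        ∑ j, C (L.symm.linear (Pi.single j 1) i) * (G j - C (eval p (G j))) := by
      have e1 := substAffine_component h i
      have e2 := congrArg (eval p) e1
      rw [eval_substAffine] at e2
      rw [map_sub, e1, e2, ← algebraMap_eq, AlgHom.commutes, algebraMap_eq]
      simp only [map_add, map_sum, map_mul, eval_C, mul_sub, Finset.sum_sub_distrib]
      ring
    rw [e]
    exact Ideal.sum_mem _ fun j _ => Ideal.mul_mem_left _ _ (component_mem_fibreIdeal G p j)
  have := hle hf'
  rwa [Ideal.mem_comap, substAffine_substAffine_symm] at this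

theorem selfIntersectionSet_of_orbit {F G : Triple} {L : (Fin 3 → ℂ) ≃ᵃ[ℂ] (Fin 3 → ℂ)}
    {R : (Fin 2 → ℂ) ≃ᵃ[ℂ] (Fin 2 → ℂ)} (h : ∀ p, toMap G p = L (toMap F (R p))) :
    selfIntersectionSet G = R ⁻¹' selfIntersectionSet F := by
  ext p
  refine not_congr ⟨fun hp => ?_, fun hp => fibreIdeal_eq_of_orbit h hp⟩
  refine fibreIdeal_eq_of_orbit (L := L.symm) (R := R.symm) (G := F) (F := G) (fun q => by simp [h]) ?_
  rwa [R.symm_apply_apply]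


/-! ### The self-intersection set of the normal form -/

theorem mem_of_C_mul_mem {σ : Type*} {J : Ideal (MvPolynomial σ ℂ)} {c : ℂ} (hc : c ≠ 0)
    {f : MvPolynomial σ ℂ} (h : C c * f ∈ J) : f ∈ J :=
  (Ideal.unit_mul_mem_iff_mem J ((isUnit_iff_ne_zero.mpr hc).map C)).mp h

theorem vanishingIdeal_singleton_le {J : Ideal (MvPolynomial (Fin 2) ℂ)} {p : Fin 2 → ℂ}
    (h : ∀ i, X i - C (p i) ∈ J) : vanishingIdeal ℂ {p} ≤ J := by
  intro f hf
  rw [mem_vanishingIdeal_singleton_iff] at hf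
  have key : ∀ g : MvPolynomial (Fin 2) ℂ, g - C (aeval p g) ∈ J := by
    intro g
    induction g using MvPolynomial.induction_on with
    | C a => simp
    | add f g hf hg =>
      have := J.add_mem hf hg
      rw [map_add, map_add]
      convert this using 1
      ring
    | mul_X f i hf =>
      have := J.add_mem (J.mul_mem_left (X i) hf) (J.mul_mem_left (C (aeval p f)) (h i))
      rw [map_mul, aeval_X, map_mul]
      convert this using 1
      ring
  simpa [hf] using key f

theorem fibreIdeal_normalForm_eq {p : Fin 2 → ℂ} (h0 : p 0 ≠ 0) (h1 : p 1 ≠ 0) :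
    fibreIdeal normalForm p = vanishingIdeal ℂ {p} := by
  refine le_antisymm (fibreIdeal_le _ _) ?_
  have g0 : X 0 ^ 2 + X 0 - (C (p 0) ^ 2 + C (p 0)) ∈ fibreIdeal normalForm p := by
    simpa [normalForm] using component_mem_fibreIdeal normalForm p 0
  have g1 : X 0 * X 1 - C (p 0) * C (p 1) ∈ fibreIdeal normalForm p := by
    simpa [normalForm] using component_mem_fibreIdeal normalForm p 1
  have g2 : X 1 ^ 2 - C (p 1) ^ 2 ∈ fibreIdeal normalForm p := by
    simpa [normalForm] using component_mem_fibreIdeal normalForm p 2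
  generalize fibreIdeal normalForm p = J at *
  have hl : C (p 1) * X 0 - C (p 0) * X 1 ∈ J := by
    refine mem_of_C_mul_mem h1 ?_
    have := J.sub_mem (J.mul_mem_left (X 1) g1) (J.mul_mem_left (X 0) g2)
    convert this using 1
    ring
  have hx : X 0 - C (p 0) ∈ J := by
    refine mem_of_C_mul_mem h1 (mem_of_C_mul_mem h1 ?_)
    have := J.sub_mem (J.sub_mem (J.mul_mem_left (C (p 1) ^ 2) g0)
      (J.mul_mem_left (C (p 1) * X 0 + C (p 0) * X 1) hl)) (J.mul_mem_left (C (p 0) ^ 2) g2)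
    convert this using 1
    ring
  have hy : X 1 - C (p 1) ∈ J := by
    refine mem_of_C_mul_mem h0 ?_
    have := J.sub_mem (J.mul_mem_left (C (p 1)) hx) hl
    convert this using 1
    ring
  refine vanishingIdeal_singleton_le fun i => ?_
  fin_cases i
  exacts [hx, hy]

theorem selfIntersectionSet_normalForm :
    selfIntersectionSet normalForm = {p | p 1 = 0 ∨ p 0 = 0} := by
  ext p
  simp only [selfIntersectionSet, Set.mem_ofPred_eq]
  constructor
  · intro h
    by_contra! hc
    exact h (fibreIdeal_normalForm_eq hc.2 hc.1)
  · intro h heq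
    have hmem : ∀ i, X i - C (p i) ∈ fibreIdeal normalForm p := by
      intro i
      rw [heq, mem_vanishingIdeal_singleton_iff]
      simp
    -- Restricted to the axis through p, the generators are multiples of one quadratic polynomial,
    -- which cannot divide the linear X - p. This covers double fibres and ramified ones alike.
    have hdvd : ∀ (φ : MvPolynomial (Fin 2) ℂ →ₐ[ℂ] Polynomial ℂ) (g : Polynomial ℂ),
        (∀ i, g ∣ φ (normalForm i - C (eval p (normalForm i)))) → ∀ i, g ∣ φ (X i - C (p i)) := by
      intro φ g hg i
      have hle : fibreIdeal normalForm p ≤ (Ideal.span {g}).comap φ := by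
        rw [fibreIdeal, Ideal.span_le]
        rintro _ ⟨j, rfl⟩
        exact Ideal.mem_span_singleton.mpr (hg j)
      exact Ideal.mem_span_singleton.mp (hle (hmem i))
    rcases h with h | h
    · have h1 := hdvd (aeval ![Polynomial.X, 0])
        (Polynomial.X ^ 2 + Polynomial.X - Polynomial.C (p 0 ^ 2 + p 0)) (fun i => by
          fin_cases i <;> simp [normalForm, h, ← algebraMap_eq]) 0
      have h2 := Polynomial.natDegree_le_of_dvd h1 (by
        simp [← algebraMap_eq, Polynomial.X_sub_C_ne_zero])
      have h3 : (Polynomial.X ^ 2 + Polynomial.X - Polynomial.C (p 0 ^ 2 + p 0)).natDegree = 2 := by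
        compute_degree!
      have h4 : (aeval ![Polynomial.X, 0] (X 0 - C (p 0)) : Polynomial ℂ).natDegree = 1 := by
        simp [← algebraMap_eq]
      omega
    · have h1 := hdvd (aeval ![0, Polynomial.X])
        (Polynomial.X ^ 2 - Polynomial.C (p 1 ^ 2)) (fun i => by
          fin_cases i <;> simp [normalForm, h, ← algebraMap_eq]) 1
      have h2 := Polynomial.natDegree_le_of_dvd h1 (by
        simp [← algebraMap_eq, Polynomial.X_sub_C_ne_zero])
      have h3 : (Polynomial.X ^ 2 - Polynomial.C (p 1 ^ 2)).natDegree = 2 := by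
        compute_degree!
      have h4 : (aeval ![0, Polynomial.X] (X 1 - C (p 1)) : Polynomial ℂ).natDegree = 1 := by
        simp [← algebraMap_eq]
      omega

/-! ### The self-intersection ideal -/

/-- The ideal of the fibre product of the plane with itself over a polynomial map. -/
def fibreProductIdeal (F : Triple) : Ideal (MvPolynomial (Fin 2 ⊕ Fin 2) ℂ) :=
  Ideal.span (Set.range fun i => rename Sum.inl (F i) - rename Sum.inr (F i))

theorem component_mem_fibreProductIdeal (F : Triple) (i : Fin 3) :
    rename Sum.inl (F i) - rename Sum.inr (F i) ∈ fibreProductIdeal F :=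
  Ideal.subset_span ⟨i, rfl⟩

theorem mem_selfIntersectionIdeal {F : Triple} {r : MvPolynomial (Fin 2) ℂ} :
    r ∈ selfIntersectionIdeal F ↔
      ∀ j, rename Sum.inl r * (X (Sum.inl j) - X (Sum.inr j)) ∈ fibreProductIdeal F := by
  rw [selfIntersectionIdeal, Ideal.mem_comap, Ideal.colon_span, Submodule.mem_colon]
  simp only [Set.forall_mem_range, smul_eq_mul, fibreProductIdeal]

/-- An affine substitution in both copies of the plane. -/
def substAffineTwice (R : (Fin 2 → ℂ) ≃ᵃ[ℂ] (Fin 2 → ℂ)) :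
    MvPolynomial (Fin 2 ⊕ Fin 2) ℂ →ₐ[ℂ] MvPolynomial (Fin 2 ⊕ Fin 2) ℂ :=
  aeval (Sum.elim (fun i => rename Sum.inl (affineCoord R i))
    (fun i => rename Sum.inr (affineCoord R i)))

theorem substAffineTwice_rename_inl (R : (Fin 2 → ℂ) ≃ᵃ[ℂ] (Fin 2 → ℂ))
    (f : MvPolynomial (Fin 2) ℂ) :
    substAffineTwice R (rename Sum.inl f) = rename Sum.inl (substAffine R f) := by
  have : (substAffineTwice R).comp (rename Sum.inl) = (rename Sum.inl).comp (substAffine R) := by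
    ext i : 1
    simp [substAffineTwice, substAffine]
  exact DFunLike.congr_fun this f

theorem substAffineTwice_rename_inr (R : (Fin 2 → ℂ) ≃ᵃ[ℂ] (Fin 2 → ℂ))
    (f : MvPolynomial (Fin 2) ℂ) :
    substAffineTwice R (rename Sum.inr f) = rename Sum.inr (substAffine R f) := by
  have : (substAffineTwice R).comp (rename Sum.inr) = (rename Sum.inr).comp (substAffine R) := by
    ext i : 1
    simp [substAffineTwice, substAffine]
  exact DFunLike.congr_fun this f

theorem substAffineTwice_difference (R : (Fin 2 → ℂ) ≃ᵃ[ℂ] (Fin 2 → ℂ)) (k : Fin 2) :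
    substAffineTwice R (X (Sum.inl k) - X (Sum.inr k)) =
      ∑ j, C (R.linear (Pi.single j 1) k) * (X (Sum.inl j) - X (Sum.inr j)) := by
  simp [substAffineTwice, affineCoord, linePoly]
  ring

theorem substAffineTwice_mem {F G : Triple} {L : (Fin 3 → ℂ) ≃ᵃ[ℂ] (Fin 3 → ℂ)}
    {R : (Fin 2 → ℂ) ≃ᵃ[ℂ] (Fin 2 → ℂ)} (h : ∀ p, toMap G p = L (toMap F (R p)))
    {f : MvPolynomial (Fin 2 ⊕ Fin 2) ℂ} (hf : f ∈ fibreProductIdeal F) :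
    substAffineTwice R f ∈ fibreProductIdeal G := by
  have hle : fibreProductIdeal F ≤ (fibreProductIdeal G).comap (substAffineTwice R) := by
    rw [fibreProductIdeal, Ideal.span_le]
    rintro _ ⟨i, rfl⟩
    rw [SetLike.mem_coe, Ideal.mem_comap]
    have e : substAffineTwice R (rename Sum.inl (F i) - rename Sum.inr (F i)) =
        ∑ j, C (L.symm.linear (Pi.single j 1) i) *
          (rename Sum.inl (G j) - rename Sum.inr (G j)) := by
      rw [map_sub, substAffineTwice_rename_inl, substAffineTwice_rename_inr,
        substAffine_component h i]
      simp only [map_add, map_sum, map_mul, rename_C, mul_sub, Finset.sum_sub_distrib]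
      ring
    rw [e]
    exact Ideal.sum_mem _ fun j _ => Ideal.mul_mem_left _ _ (component_mem_fibreProductIdeal G j)
  exact hle hf

theorem substAffine_mem_selfIntersectionIdeal {F G : Triple}
    {L : (Fin 3 → ℂ) ≃ᵃ[ℂ] (Fin 3 → ℂ)} {R : (Fin 2 → ℂ) ≃ᵃ[ℂ] (Fin 2 → ℂ)}
    (h : ∀ p, toMap G p = L (toMap F (R p))) {r : MvPolynomial (Fin 2) ℂ}
    (hr : r ∈ selfIntersectionIdeal F) : substAffine R r ∈ selfIntersectionIdeal G := by
  rw [mem_selfIntersectionIdeal] at hr ⊢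
  intro j
  have hk : ∀ k, rename Sum.inl (substAffine R r) *
      substAffineTwice R (X (Sum.inl k) - X (Sum.inr k)) ∈ fibreProductIdeal G := fun k => by
    rw [← substAffineTwice_rename_inl, ← map_mul]
    exact substAffineTwice_mem h (hr k)
  -- The inverse of the linear part of R recovers the differences from the substituted ones.
  have e : (X (Sum.inl j) - X (Sum.inr j) : MvPolynomial (Fin 2 ⊕ Fin 2) ℂ) =
      ∑ k, C (R.symm.linear (Pi.single k 1) j) *
        substAffineTwice R (X (Sum.inl k) - X (Sum.inr k)) := by
    have hinv : ∀ l, ∑ k, R.symm.linear (Pi.single k 1) j * R.linear (Pi.single l 1) k =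
        (Pi.single l 1 : Fin 2 → ℂ) j := by
      intro l
      rw [← affineEquiv_linear_apply]
      have : R.symm.linear (R.linear (Pi.single l 1)) = Pi.single l 1 :=
        R.linear.symm_apply_apply _
      rw [this]
    simp only [substAffineTwice_difference, Finset.mul_sum]
    rw [Finset.sum_comm]
    simp only [← mul_assoc, ← Finset.sum_mul, ← map_mul, ← map_sum, hinv]
    rw [Finset.sum_eq_single j]
    · simp
    · intro b _ hb
      simp [hb.symm]
    · simp
  rw [e, Finset.mul_sum]
  refine Ideal.sum_mem _ fun k _ => ?_
  rw [mul_left_comm]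
  exact Ideal.mul_mem_left _ _ (hk k)

theorem selfIntersectionIdeal_of_orbit {F G : Triple} {L : (Fin 3 → ℂ) ≃ᵃ[ℂ] (Fin 3 → ℂ)}
    {R : (Fin 2 → ℂ) ≃ᵃ[ℂ] (Fin 2 → ℂ)} (h : ∀ p, toMap G p = L (toMap F (R p)))
    {f : MvPolynomial (Fin 2) ℂ} (hf : selfIntersectionIdeal F = Ideal.span {f}) :
    selfIntersectionIdeal G = Ideal.span {substAffine R f} := by
  ext r
  rw [Ideal.mem_span_singleton]
  constructor
  · intro hr
    have hr' := substAffine_mem_selfIntersectionIdeal (F := G) (G := F) (L := L.symm)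
      (R := R.symm) (fun q => by simp [h]) hr
    rw [hf, Ideal.mem_span_singleton] at hr'
    have := map_dvd (substAffine R) hr'
    rwa [substAffine_substAffine_symm] at this
  · rintro ⟨s, rfl⟩
    refine Ideal.mul_mem_right _ _ (substAffine_mem_selfIntersectionIdeal h ?_)
    rw [hf]
    exact Ideal.mem_span_singleton_self f

/-! ### The self-intersection ideal of the normal form -/

theorem exists_expansion_y (r : MvPolynomial (Fin 2) ℂ) :
    ∃ (a b : Polynomial ℂ) (s : MvPolynomial (Fin 2) ℂ),
      r = Polynomial.aeval (X 0) a + Polynomial.aeval (X 0) b * X 1 + X 1 ^ 2 * s := by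
  induction r using MvPolynomial.induction_on with
  | C c => exact ⟨Polynomial.C c, 0, 0, by simp [algebraMap_eq]⟩
  | add f g hf hg =>
    obtain ⟨a, b, s, rfl⟩ := hf
    obtain ⟨a', b', s', rfl⟩ := hg
    exact ⟨a + a', b + b', s + s', by simp only [map_add]; ring⟩
  | mul_X f i hf =>
    obtain ⟨a, b, s, rfl⟩ := hf
    fin_cases i
    · exact ⟨a * Polynomial.X, b * Polynomial.X, s * X 0, by
        simp only [map_mul, Polynomial.aeval_X, Fin.zero_eta]; ring⟩
    · exact ⟨0, a, Polynomial.aeval (X 0) b + s * X 1, by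
        simp only [map_zero, Fin.mk_one]; ring⟩

theorem exists_expansion_x (r : MvPolynomial (Fin 2) ℂ) :
    ∃ (a : Polynomial ℂ) (s : MvPolynomial (Fin 2) ℂ),
      r = Polynomial.aeval (X 1) a + X 0 * s := by
  induction r using MvPolynomial.induction_on with
  | C c => exact ⟨Polynomial.C c, 0, by simp [algebraMap_eq]⟩
  | add f g hf hg =>
    obtain ⟨a, s, rfl⟩ := hf
    obtain ⟨a', s', rfl⟩ := hg
    exact ⟨a + a', s + s', by simp only [map_add]; ring⟩
  | mul_X f i hf =>
    obtain ⟨a, s, rfl⟩ := hf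
    fin_cases i
    · exact ⟨0, Polynomial.aeval (X 1) a + s * X 0, by simp only [map_zero, Fin.zero_eta]; ring⟩
    · exact ⟨a * Polynomial.X, s * X 1, by
        simp only [map_mul, Polynomial.aeval_X, Fin.mk_one]; ring⟩

/-- Two `A`-valued points u, v with equal image form a point of the fibre product, at which the
members of its ideal vanish. Suitable rings `A` turn this into divisibility conditions on r. -/
theorem map_mul_eq_zero_of_mem {A : Type*} [CommRing A] [Algebra ℂ A] {F : Triple}
    {r : MvPolynomial (Fin 2) ℂ} (hr : r ∈ selfIntersectionIdeal F) (u v : Fin 2 → A)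
    (h : ∀ i, aeval u (F i) = aeval v (F i)) (j : Fin 2) : aeval u r * (u j - v j) = 0 := by
  have hle : fibreProductIdeal F ≤ RingHom.ker (aeval (R := ℂ) (Sum.elim u v)) := by
    rw [fibreProductIdeal, Ideal.span_le]
    rintro _ ⟨i, rfl⟩
    rw [SetLike.mem_coe, RingHom.mem_ker, map_sub, aeval_rename, aeval_rename, sub_eq_zero]
    exact h i
  have := hle (mem_selfIntersectionIdeal.mp hr j)
  rw [RingHom.mem_ker, map_mul, aeval_rename] at this
  simpa using this

theorem sq_dvd_of_mem_selfIntersectionIdeal {r : MvPolynomial (Fin 2) ℂ}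
    (hr : r ∈ selfIntersectionIdeal normalForm) : X 1 ^ 2 ∣ r := by
  obtain ⟨a, b, s, rfl⟩ := exists_expansion_y r
  let x : DualNumber (Polynomial ℂ) := TrivSqZeroExt.inl Polynomial.X
  have heps : (DualNumber.eps : DualNumber (Polynomial ℂ)) * DualNumber.eps = 0 :=
    DualNumber.eps_mul_eps
  -- The points (x, 0) and (-1 - x, 0) share their image, and the vertical velocities x + 1 and -x
  -- keep the xy components equal to first order. Thus r vanishes to order two along y = 0.
  have h := map_mul_eq_zero_of_mem hr ![x, (x + 1) * DualNumber.eps]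
    ![-1 - x, -x * DualNumber.eps] (fun i => by
      fin_cases i
      · simp [normalForm]; ring
      · simp [normalForm]; ring
      · simp [normalForm]
        linear_combination (2 * x + 1) * heps) 0
  have hx : ∀ q : Polynomial ℂ, Polynomial.aeval x q = TrivSqZeroExt.inl q := by
    intro q
    have := Polynomial.aeval_algHom_apply (TrivSqZeroExt.inlAlgHom ℂ (Polynomial ℂ) (Polynomial ℂ))
      Polynomial.X q
    simpa [x] using this
  have hr' : aeval ![x, (x + 1) * DualNumber.eps] (Polynomial.aeval (X 0) a +
      Polynomial.aeval (X 0) b * X 1 + X 1 ^ 2 * s) =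
      TrivSqZeroExt.inl a + TrivSqZeroExt.inl b * ((x + 1) * DualNumber.eps) := by
    have e : ∀ q : Polynomial ℂ, aeval ![x, (x + 1) * DualNumber.eps]
        (Polynomial.aeval (X 0 : MvPolynomial (Fin 2) ℂ) q) = TrivSqZeroExt.inl q := by
      intro q
      rw [← Polynomial.aeval_algHom_apply, aeval_X]
      exact hx q
    simp only [map_add, map_mul, map_pow, e, aeval_X, Matrix.cons_val]
    linear_combination (x + 1) ^ 2 * aeval ![x, (x + 1) * DualNumber.eps] s * heps
  rw [hr'] at h
  have hne : (2 * Polynomial.X + 1 : Polynomial ℂ) ≠ 0 := fun h0 => by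
    have := congrArg (Polynomial.eval 0) h0
    simp at this
  have hne' : (Polynomial.X + 1 : Polynomial ℂ) ≠ 0 := fun h0 => by
    have := congrArg (Polynomial.eval 0) h0
    simp at this
  have ha : a = 0 := by
    have h1 := congrArg TrivSqZeroExt.fst h
    simp [x] at h1
    refine h1.resolve_right fun h2 => hne ?_
    linear_combination h2
  have hb : b = 0 := by
    have h1 := congrArg TrivSqZeroExt.snd h
    simp [x, ha] at h1
    refine (h1.resolve_right fun h2 => hne ?_).resolve_right hne'
    linear_combination h2
  rw [ha, hb]
  exact ⟨s, by simp⟩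

theorem selfIntersectionIdeal_normalForm :
    selfIntersectionIdeal normalForm = Ideal.span {X 1 ^ 2 * X 0} := by
  ext r
  rw [Ideal.mem_span_singleton]
  constructor
  · intro hr
    obtain ⟨s, rfl⟩ := sq_dvd_of_mem_selfIntersectionIdeal hr
    obtain ⟨a, s, rfl⟩ := exists_expansion_x s
    -- The pair (0, y), (0, -y) forces the cofactor of y² to vanish on x = 0.
    have h := map_mul_eq_zero_of_mem (A := Polynomial ℂ) hr ![0, Polynomial.X] ![0, -Polynomial.X] (fun i => by
      fin_cases i <;> simp [normalForm]) 1
    have e : aeval ![0, Polynomial.X] (Polynomial.aeval (X 1 : MvPolynomial (Fin 2) ℂ) a) = a := by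
      rw [← Polynomial.aeval_algHom_apply, aeval_X]
      simp
    simp [e] at h
    rw [h]
    exact ⟨s, by simp; ring⟩
  · rintro ⟨s, rfl⟩
    refine Ideal.mul_mem_right _ _ ?_
    rw [mem_selfIntersectionIdeal]
    -- Explicit membership certificates over the three generators; the factors 4 and 8 clear
    -- denominators.
    have key : ∀ x₁ y₁ x₂ y₂ : MvPolynomial (Fin 2 ⊕ Fin 2) ℂ,
        ∀ J : Ideal (MvPolynomial (Fin 2 ⊕ Fin 2) ℂ), x₁ ^ 2 + x₁ - (x₂ ^ 2 + x₂) ∈ J →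
        x₁ * y₁ - x₂ * y₂ ∈ J → y₁ ^ 2 - y₂ ^ 2 ∈ J →
        y₁ ^ 2 * x₁ * (x₁ - x₂) ∈ J ∧ y₁ ^ 2 * x₁ * (y₁ - y₂) ∈ J := by
      intro x₁ y₁ x₂ y₂ J g0 g1 g2
      have h4 : (4 : ℂ) ≠ 0 := by norm_num
      have h8 : (8 : ℂ) ≠ 0 := by norm_num
      constructor
      · refine mem_of_C_mul_mem h4 ?_
        have := J.add_mem (J.add_mem (J.mul_mem_left (x₁ * (y₁ - y₂) ^ 2) g0)
          (J.mul_mem_left (2 * x₁ * ((y₁ + y₂) - (x₁ - x₂) * (y₁ - y₂))) g1))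
          (J.mul_mem_left (x₁ * ((x₁ - x₂) ^ 2 + 2 * (x₁ - x₂) - (x₁ + x₂))) g2)
        convert this using 1
        simp only [map_ofNat]
        ring
      · refine mem_of_C_mul_mem h8 ?_
        have := J.add_mem (J.add_mem (J.mul_mem_left ((y₁ - y₂) ^ 3) g0)
          (J.mul_mem_left (2 * (y₁ - y₂) ^ 2 * (1 - (x₁ - x₂))) g1))
          (J.mul_mem_left ((y₁ - y₂) * ((x₁ - x₂) ^ 2 - (x₁ - x₂)) +
            2 * x₁ * (2 * (y₁ - y₂) + (y₁ + y₂))) g2)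
        convert this using 1
        simp only [map_ofNat]
        ring
    have h := key (X (Sum.inl 0)) (X (Sum.inl 1)) (X (Sum.inr 0)) (X (Sum.inr 1))
      (fibreProductIdeal normalForm)
      (by simpa [normalForm] using component_mem_fibreProductIdeal normalForm 0)
      (by simpa [normalForm] using component_mem_fibreProductIdeal normalForm 1)
      (by simpa [normalForm] using component_mem_fibreProductIdeal normalForm 2)
    intro j
    simp only [map_mul, map_pow, rename_X]
    fin_cases j
    exacts [h.1, h.2]


/-! ### Transport from the normal form and the single orbit -/

theorem det_affineCoord_ne_zero (R : (Fin 2 → ℂ) ≃ᵃ[ℂ] (Fin 2 → ℂ)) :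
    R.linear (Pi.single 0 1) 1 * R.linear (Pi.single 1 1) 0 -
      R.linear (Pi.single 0 1) 0 * R.linear (Pi.single 1 1) 1 ≠ 0 := by
  obtain ⟨v, hv⟩ := R.linear.surjective (Pi.single 0 1)
  obtain ⟨w, hw⟩ := R.linear.surjective (Pi.single 1 1)
  have hv0 := affineEquiv_linear_apply R v 0
  have hv1 := affineEquiv_linear_apply R v 1
  have hw0 := affineEquiv_linear_apply R w 0
  have hw1 := affineEquiv_linear_apply R w 1
  rw [hv, Fin.sum_univ_two] at hv0 hv1
  rw [hw, Fin.sum_univ_two] at hw0 hw1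
  rw [Pi.single_eq_same] at hv0 hw1
  rw [Pi.single_eq_of_ne (by decide)] at hv1 hw0
  intro h
  generalize R.linear (Pi.single 0 1) 0 = a₀ at *
  generalize R.linear (Pi.single 1 1) 0 = b₀ at *
  generalize R.linear (Pi.single 0 1) 1 = a₁ at *
  generalize R.linear (Pi.single 1 1) 1 = b₁ at *
  -- The preimages v, w of the basis vectors are the columns of an inverse matrix, so a zero
  -- determinant would give 1 = 0.
  refine one_ne_zero (α := ℂ) ?_
  linear_combination hv0 + (a₀ * v 0 + b₀ * v 1) * hw1 - (a₀ * w 0 + b₀ * w 1) * hv1 -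
    (v 0 * w 1 - v 1 * w 0) * h

theorem selfIntersection_of_mem_orbit {F : Triple} (h : F ∈ orbit normalForm) :
    ∃ a₁ b₁ c₁ a₂ b₂ c₂ : ℂ, a₁ * b₂ - a₂ * b₁ ≠ 0 ∧
      selfIntersectionSet F = {p | eval p (linePoly a₁ b₁ c₁) = 0} ∪
        {p | eval p (linePoly a₂ b₂ c₂) = 0} ∧
      selfIntersectionIdeal F = Ideal.span {linePoly a₁ b₁ c₁ ^ 2 * linePoly a₂ b₂ c₂} := by
  obtain ⟨-, L, R, h⟩ := h
  refine ⟨_, _, _, _, _, _, det_affineCoord_ne_zero R, ?_,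
    (selfIntersectionIdeal_of_orbit h selfIntersectionIdeal_normalForm).trans
      (by rw [map_mul, map_pow, substAffine, aeval_X, aeval_X]; rfl)⟩
  rw [selfIntersectionSet_of_orbit h, selfIntersectionSet_normalForm]
  ext p
  have h0 := eval_affineCoord R 0 p
  have h1 := eval_affineCoord R 1 p
  rw [affineCoord] at h0 h1
  simp only [Set.mem_preimage, Set.mem_ofPred_eq, Set.mem_union, h0, h1]

theorem half_ne_cuspidal (ε : ℂ) (hε : ε ^ 3 = 1) :
    ((1 / 2, 1 / 2) : ℂ × ℂ) ≠ (-(3 / 2) * ε, -(3 / 2) * ε ^ 2) := by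
  intro h
  have h1 := congrArg Prod.fst h
  simp only at h1
  have h2 : ε = -1 / 3 := by linear_combination (2 / 3) * h1
  rw [h2] at hε
  norm_num at hε

theorem ncard_criticalSet_family_half : (criticalSet (family (1 / 2) (1 / 2))).ncard = 2 :=
  ncard_criticalSet_family (by norm_num) half_ne_cuspidal

theorem mem_orbit_of_ncard_eq_two {F G : Triple} (hF : F ∈ Omega) (hG : G ∈ Omega)
    (hF2 : (criticalSet F).ncard = 2) (hG2 : (criticalSet G).ncard = 2) : F ∈ orbit G :=
  mem_orbit_trans (normalForm_mem_orbit_of_ncard_eq_two hG hG2)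
    (mem_orbit_symm hF (normalForm_mem_orbit_of_ncard_eq_two hF hF2))

/-- The number of singular points is an orbit invariant and the value two determines the orbit, so
the orbit's dimension is that of the discriminant locus studied above. -/
theorem orbit_eq_twoCritical {F : Triple} (hF : F ∈ Omega) (h : (criticalSet F).ncard = 2) :
    orbit F = twoCritical := by
  ext G
  exact ⟨fun hG => ⟨hG.1, (ncard_criticalSet_of_mem_orbit hF hG).trans h⟩,
    fun hG => mem_orbit_of_ncard_eq_two hG.1 hF hG.2 h⟩

end QuadMap

end

theorem mainTheorem4 (F : QuadMap.Triple) (hF : F ∈ QuadMap.Omega) :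
    List.TFAE [
      (QuadMap.criticalSet F).ncard = 2,
      ∃ a b : ℂ,
        2 * a ^ 3 + a ^ 2 * b ^ 2 + 9 / 2 * a * b + 2 * b ^ 3 - 27 / 16 = 0 ∧
        (∀ ε : ℂ, ε ^ 3 = 1 → (a, b) ≠ (-(3 / 2) * ε, -(3 / 2) * ε ^ 2)) ∧
        QuadMap.family a b ∈ QuadMap.orbit F,
      QuadMap.orbit F = QuadMap.orbit (QuadMap.family (1 / 2) (1 / 2)),
      F ∈ QuadMap.orbit (QuadMap.family (1 / 2) (1 / 2))] ∧
    ((QuadMap.criticalSet F).ncard = 2 →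
      QuadMap.HasTopDegree F 1 ∧
      (∃ a₁ b₁ c₁ a₂ b₂ c₂ : ℂ, a₁ * b₂ - a₂ * b₁ ≠ 0 ∧
        QuadMap.selfIntersectionSet F =
          {p | MvPolynomial.eval p (QuadMap.linePoly a₁ b₁ c₁) = 0} ∪
          {p | MvPolynomial.eval p (QuadMap.linePoly a₂ b₂ c₂) = 0} ∧
        QuadMap.selfIntersectionIdeal F =
          Ideal.span {QuadMap.linePoly a₁ b₁ c₁ ^ 2 * QuadMap.linePoly a₂ b₂ c₂}) ∧
      QuadMap.dimension (QuadMap.orbit F) = 17) := by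
  open QuadMap in
  constructor
  · tfae_have 1 → 4 := fun h =>
      mem_orbit_of_ncard_eq_two hF (family_mem_Omega _ _) h ncard_criticalSet_family_half
    tfae_have 4 → 3 := fun h => orbit_eq_of_mem (family_mem_Omega _ _) h
    tfae_have 3 → 2 := fun h => by
      refine ⟨1 / 2, 1 / 2, by norm_num, half_ne_cuspidal, ?_⟩
      rw [h]
      exact mem_orbit_self (family_mem_Omega _ _)
    tfae_have 2 → 1 := by
      rintro ⟨a, b, h, hab, hmem⟩
      rw [← ncard_criticalSet_of_mem_orbit hF hmem]
      exact ncard_criticalSet_family h hab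
    tfae_finish
  · intro h
    have hN := mem_orbit_symm hF (normalForm_mem_orbit_of_ncard_eq_two hF h)
    refine ⟨hasTopDegree_normalForm.of_mem_orbit hN, selfIntersection_of_mem_orbit hN, ?_⟩
    rw [orbit_eq_twoCritical hF h]
    exact dimension_twoCritical
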